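/- Let $X$ be a complex Banach space, let $A$ be the generator of an exponentially stable $C_0$-semigroup $T(\cdot)$ on $X$ (i.e. $\|T(t)\|\le Me^{-\omega t}$ for all $t\ge 0$, with some $\omega>0$), and let $X_1$ be $D(A)$ with the graph norm $\|x\|+\|Ax\|$. Let $\mathcal H^\infty_-$ be the space of bounded holomorphic functions on $\{\operatorname{Re} z<0\}$, with the supremum norm $\|\cdot\|_\infty$. For $g\in\mathcal H^\infty_-$ let $M_g f=\mathfrak L^{-1}\Pi(g\cdot\mathfrak L f)$ be the Toeplitz operator on $L^2(0,\infty)$; here $\mathfrak L$ is the Laplace transform, $g$ and $\mathfrak L f$ are identified with their boundary functions on $i\mathbb R$, and $\Pi$ is the orthogonal projection of $L^2(i\mathbb R)$ onto the Hardy space $\mathcal H^2=\mathfrak L(L^2(0,\infty))$. For a complex Banach space $Z$, a weakly admissible output mapping is a bounded bilinear map $B:X\times Z\to L^2(0,\infty)$ with $B(x,y)(\cdot+\tau)=B(T(\tau)x,y)$ for all $\tau>0$, $x\in X$, $y\in Z$. Primes denote dual spaces and dual operators, and $\langle\cdot,\cdot\rangle$ is the bilinear duality pairing. (i) For every complex Banach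 space $Z$, every weakly admissible output mapping $B:X\times Z\to L^2(0,\infty)$ and every $g\in\mathcal H^\infty_-$ there is a unique $g^B(A)\in\mathcal B(X_1,Z')$ such that $$M_g(B(x_1,y))=\langle y,g^B(A)T(\cdot)x_1\rangle_{Z,Z'}\quad\text{in }L^2(0,\infty),\qquad x_1\in D(A),\ y\in Z.$$ (ii) If $Z=X'$ and $B(x,y)=\langle y,T(\cdot)x\rangle$ (which is a weakly admissible output mapping), then for every $g\in\mathcal H^\infty_-$ the operator $g^B(A)$ takes its values in $X\subset X''$ and lies in $\mathcal B(X_1,X)$, and $M_g(B(x_1,y))=\langle y,g^B(A)T(\cdot)x_1\rangle_{X',X}$ in $L^2(0,\infty)$ for $x_1\in D(A)$, $y\in X'$. (iii) For every weakly admissible output mapping $B:X\times Z\to L^2(0,\infty)$ there is a constant $\alpha>0$ such that for all $g\in\mathcal H^\infty_-$, all $s\in\mathbb C$ with $\operatorname{Re}s>0$ and all $x\in X$ the inverse $(s-A)^{-1}\in\mathcal B(X,X_1)$ exists and $$\|g^B(A)(s-A)^{-1}x\|_{Z'}\le\frac{\alpha}{\sqrt{\operatorname{Re}s}}\,\|g\|_\infty\|x\|.$$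 (iv) If $Z=X'$ and $B$ is a weakly admissible output mapping with $B(T(t)x,y)=B(x,T(t)'y)$ for all $t\ge0$, $x\in X$, $y\in X'$, then for every $g\in\mathcal H^\infty_-$ the operator $g^B(A)$ commutes with the semigroup, i.e. $$\langle y,g^B(A)T(t)x_1\rangle_{X',X''}=\langle T(t)'y,g^B(A)x_1\rangle_{X',X''}$$ for all $x_1\in D(A)$, $y\in X'$ and $t\ge0$. -/

import Mathlib

open Set Filter Topology MeasureTheory
open scoped NNReal ENNReal FourierTransform

noncomputable section

/-! ### Strongly continuous semigroups and their generators -/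

/-- A `C₀`-semigroup of bounded operators on a complex normed space `X`. -/
structure C0Semigroup (X : Type*) [NormedAddCommGroup X] [NormedSpace ℂ X] where
  /-- the operator `T(t)`, for `t ≥ 0` -/
  op : ℝ≥0 → X →L[ℂ] X
  op_zero : op 0 = ContinuousLinearMap.id ℂ X
  op_add : ∀ s t : ℝ≥0, op (s + t) = (op s).comp (op t)
  strong_cont : ∀ x : X, Tendsto (fun t : ℝ≥0 => op t x) (𝓝 0) (𝓝 x)

/-- The space `X₁`: the domain `D(A)` of an operator `A`, to be normed by the graph norm. -/
def GraphDomain {X : Type*} [NormedAddCommGroup X] [NormedSpace ℂ X] (A : X →ₗ.[ℂ] X) : Type _ :=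
  A.domain

namespace GraphDomain

variable {X : Type*} [NormedAddCommGroup X] [NormedSpace ℂ X] (A : X →ₗ.[ℂ] X)

instance : AddCommGroup (GraphDomain A) := inferInstanceAs (AddCommGroup A.domain)

instance : Module ℂ (GraphDomain A) := inferInstanceAs (Module ℂ A.domain)

/-- The inclusion `X₁ → X`. -/
def incl : GraphDomain A →ₗ[ℂ] X := A.domain.subtype

/-- The operator `A`, as a linear map `X₁ → X`. -/
def app : GraphDomain A →ₗ[ℂ] X := A.toFun

/-- The graph norm `‖x‖₁ = ‖x‖ + ‖A x‖`. -/
instance : NormedAddCommGroup (GraphDomain A) :=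
  AddGroupNorm.toNormedAddCommGroup
    { toFun := fun x => ‖incl A x‖ + ‖app A x‖
      map_zero' := by simp
      add_le' := fun x y => by
        rw [map_add, map_add]
        linarith [norm_add_le (incl A x) (incl A y), norm_add_le (app A x) (app A y)]
      neg' := fun x => by rw [map_neg, map_neg, norm_neg, norm_neg]
      eq_zero_of_map_eq_zero' := fun x hx => by
        have h : ‖incl A x‖ = 0 := by
          linarith [norm_nonneg (incl A x), norm_nonneg (app A x)]
        exact Subtype.ext (norm_eq_zero.1 h) }

theorem norm_def (x : GraphDomain A) : ‖x‖ = ‖incl A x‖ + ‖app A x‖ := rfl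

instance : NormedSpace ℂ (GraphDomain A) where
  norm_smul_le c x := by
    rw [norm_def, norm_def, map_smul, map_smul, norm_smul, norm_smul, mul_add]

end GraphDomain

namespace C0Semigroup

variable {X : Type*} [NormedAddCommGroup X] [NormedSpace ℂ X] (T : C0Semigroup X)

/-- `T` is exponentially stable: its growth bound is negative. -/
def ExpStable : Prop :=
  ∃ M ω : ℝ, 0 < ω ∧ ∀ t : ℝ≥0, ‖T.op t‖ ≤ M * Real.exp (-ω * t)

/-- `y` is the right derivative at `0` of the orbit `t ↦ T(t)x`. -/
def HasGen (x y : X) : Prop :=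
  Tendsto (fun t : ℝ≥0 => ((t : ℂ)⁻¹) • (T.op t x - x)) (𝓝[≠] 0) (𝓝 y)

variable {T}

theorem HasGen.add {x y x' y' : X} (h : T.HasGen x y) (h' : T.HasGen x' y') :
    T.HasGen (x + x') (y + y') := by
  refine (Tendsto.add h h').congr fun t => ?_
  rw [← smul_add, map_add]
  congr 1
  abel

theorem HasGen.smul {x y : X} (c : ℂ) (h : T.HasGen x y) : T.HasGen (c • x) (c • y) := by
  refine (Tendsto.const_smul h c).congr fun t => ?_
  rw [map_smul, ← smul_sub, smul_comm]

theorem hasGen_zero : T.HasGen 0 0 := by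
  simp [HasGen]

theorem HasGen.unique {x y y' : X} (h : T.HasGen x y) (h' : T.HasGen x y') : y = y' :=
  tendsto_nhds_unique h h'

theorem HasGen.map {x y : X} (t : ℝ≥0) (h : T.HasGen x y) :
    T.HasGen (T.op t x) (T.op t y) := by
  refine (((T.op t).continuous.tendsto y).comp h).congr fun s => ?_
  have h1 : T.op t (T.op s x) = T.op s (T.op t x) := by
    rw [← ContinuousLinearMap.comp_apply, ← ContinuousLinearMap.comp_apply, ← T.op_add,
      ← T.op_add, add_comm]
  simp only [Function.comp_apply, map_smul, map_sub, h1]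

variable (T)

/-- The generator `A` of the semigroup: `D(A)` is the set of all `x` for which
`lim_{t → 0+} (T(t)x - x)/t` exists, and `A x` is that limit. -/
def generator : X →ₗ.[ℂ] X where
  domain :=
    { carrier := {x | ∃ y, T.HasGen x y}
      add_mem' := fun ⟨y, hy⟩ ⟨y', hy'⟩ => ⟨y + y', hy.add hy'⟩
      zero_mem' := ⟨0, hasGen_zero⟩
      smul_mem' := fun c _ ⟨y, hy⟩ => ⟨c • y, hy.smul c⟩ }
  toFun :=
    { toFun := fun x => x.2.choose
      map_add' := fun x x' =>
        (x + x').2.choose_spec.unique (x.2.choose_spec.add x'.2.choose_spec)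
      map_smul' := fun c x => (c • x).2.choose_spec.unique (x.2.choose_spec.smul c) }

/-- The Banach space `X₁ = D(A)` with the graph norm of the generator `A`. -/
abbrev X1 : Type _ := GraphDomain T.generator

/-- The inclusion `X₁ → X`. -/
abbrev incl : T.X1 →ₗ[ℂ] X := GraphDomain.incl T.generator

/-- The generator `A : X₁ → X`. -/
abbrev gen : T.X1 →ₗ[ℂ] X := GraphDomain.app T.generator

theorem gen_spec (x : T.X1) : T.HasGen (T.incl x) (T.gen x) :=
  Exists.choose_spec x.2

/-- The operator `T(t)` restricted to `D(A)`, which it leaves invariant. -/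
def onX1 (t : ℝ≥0) (x : T.X1) : T.X1 :=
  ⟨T.op t (T.incl x), T.op t (T.gen x), (T.gen_spec x).map t⟩

theorem incl_onX1 (t : ℝ≥0) (x : T.X1) : T.incl (T.onX1 t x) = T.op t (T.incl x) := rfl

/-- `R : X → X₁` is the bounded two-sided inverse `(s - A)⁻¹` of `s - A : D(A) → X`. -/
def IsResolvent (s : ℂ) (R : X →L[ℂ] T.X1) : Prop :=
  (∀ x : X, s • T.incl (R x) - T.gen (R x) = x) ∧
    ∀ u : T.X1, R (s • T.incl u - T.gen u) = u

end C0Semigroup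

/-! ### The Laplace transform, the Hardy space and Toeplitz operators -/

/-- Bounded holomorphic functions on the left half-plane (values outside it play no role). -/
structure HInfLeft where
  toFun : ℂ → ℂ
  holo : DifferentiableOn ℂ toFun {z | z.re < 0}
  bdd : ∃ C : ℝ, ∀ z : ℂ, z.re < 0 → ‖toFun z‖ ≤ C

/-- The supremum norm on the left half-plane. -/
def HInfLeft.supNorm (g : HInfLeft) : ℝ := ⨆ z : {z : ℂ // z.re < 0}, ‖g.toFun z‖

/-- The space `L²(0,∞)`. -/
abbrev L2pos : Type := Lp ℂ 2 (volume.restrict (Ioi (0 : ℝ)))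

/-- The space `L²(ℝ)`. It represents `L²(iℝ)`: the variable `ξ` stands for the point `2πiξ`. -/
abbrev L2line : Type := Lp ℂ 2 (volume : Measure ℝ)

theorem memLp_extend (f : L2pos) :
    MemLp ((Ioi (0 : ℝ)).indicator f) 2 (volume : Measure ℝ) :=
  (memLp_indicator_iff_restrict measurableSet_Ioi).2 (Lp.memLp f)

/-- Extension by zero, `L²(0,∞) → L²(ℝ)`. -/
def extendZero : L2pos →ₗᵢ[ℂ] L2line where
  toFun f := (memLp_extend f).toLp _
  map_add' f f' := by
    rw [← MemLp.toLp_add, MemLp.toLp_eq_toLp_iff, ← indicator_add']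
    exact (ae_restrict_iff' measurableSet_Ioi).1 (Lp.coeFn_add f f') |>.mono fun t ht => by
      by_cases h : t ∈ Ioi (0 : ℝ)
      · simpa only [indicator_of_mem h] using ht h
      · simp only [indicator_of_notMem h]
  map_smul' c f := by
    rw [RingHom.id_apply, ← MemLp.toLp_const_smul, MemLp.toLp_eq_toLp_iff]
    exact (ae_restrict_iff' measurableSet_Ioi).1 (Lp.coeFn_smul c f) |>.mono fun t ht => by
      by_cases h : t ∈ Ioi (0 : ℝ)
      · simpa only [indicator_of_mem h, Pi.smul_apply] using ht h
      · simp only [indicator_of_notMem h, Pi.smul_apply, smul_zero]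
  norm_map' f := by
    change ‖(memLp_extend f).toLp _‖ = ‖f‖
    rw [Lp.norm_toLp, eLpNorm_indicator_eq_eLpNorm_restrict measurableSet_Ioi, Lp.norm_def]

/-- The Laplace transform `f ↦ ∫₀^∞ f(t) e^{-st} dt`, as the map which takes `f ∈ L²(0,∞)` to the
boundary function of its Laplace transform on the imaginary axis. At the point `s = 2πiξ` this is
the Fourier transform of `f`, extended by zero. -/
def laplace : L2pos →ₗᵢ[ℂ] L2line :=
  (Lp.fourierTransformₗᵢ ℝ ℂ).toLinearIsometry.comp extendZero

/-- The Hardy space `H²` of the right half-plane, consisting of the Laplace transforms of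
functions in `L²(0,∞)` and identified with its space of boundary functions. -/
def hardy : Submodule ℂ L2line := LinearMap.range laplace.toLinearMap

instance : CompleteSpace hardy :=
  laplace.isometry.isUniformInducing.isComplete_range.completeSpace_coe

/-- The Laplace transform as an isometric isomorphism `L²(0,∞) → H²`. -/
def laplaceEquiv : L2pos ≃ₗᵢ[ℂ] hardy := laplace.equivRange

namespace HInfLeft

variable (g : HInfLeft)

open Classical in
/-- The boundary function of `g` on the imaginary axis, at the point `2πiξ`: the limit of `g` from
inside the left half-plane (it exists for almost every `ξ`; elsewhere the value is `0`). -/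
def boundary (ξ : ℝ) : ℂ :=
  if ∃ l : ℂ, Tendsto (fun a : ℝ => g.toFun (a + 2 * Real.pi * ξ * Complex.I)) (𝓝[<] 0) (𝓝 l)
  then limUnder (𝓝[<] 0) (fun a : ℝ => g.toFun (a + 2 * Real.pi * ξ * Complex.I))
  else 0

theorem memLp_boundary : MemLp g.boundary ∞ (volume : Measure ℝ) := by
  classical
  obtain ⟨C, hC⟩ := g.bdd
  have hC0 : 0 ≤ C := (norm_nonneg _).trans (hC (-1) (by simp))
  let p : ℝ → ℝ → ℂ := fun a ξ => a + 2 * Real.pi * ξ * Complex.I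
  have hp : ∀ a ξ, (p a ξ).re = a := fun a ξ => by simp [p]
  let F : ℝ → ℝ → ℂ := fun a ξ => if a < 0 then g.toFun (p a ξ) else 0
  have hF : ∀ a, StronglyMeasurable (F a) := fun a => by
    by_cases ha : a < 0
    · simp only [F, if_pos ha]
      refine (g.holo.continuousOn.comp_continuous ?_ fun ξ => ?_).stronglyMeasurable
      · fun_prop
      · simpa [hp] using ha
    · simp only [F, if_neg ha]
      exact stronglyMeasurable_const
  have hFg : ∀ ξ, (fun a => F a ξ) =ᶠ[𝓝[<] 0] fun a => g.toFun (p a ξ) := fun ξ => by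
    filter_upwards [self_mem_nhdsWithin] with a ha
    exact if_pos ha
  let S : Set ℝ := {ξ | ∃ l : ℂ, Tendsto (fun a => F a ξ) (𝓝[<] 0) (𝓝 l)}
  have hS : MeasurableSet S := by
    let L : Filter ℚ := comap ((↑) : ℚ → ℝ) (𝓝[<] 0)
    have hSL : S = {ξ | ∃ l : ℂ, Tendsto (fun q : ℚ => F q ξ) L (𝓝 l)} := by
      ext ξ
      refine exists_congr fun l => ⟨fun h => h.comp tendsto_comap, fun h => ?_⟩
      refine (closed_nhds_basis l).tendsto_right_iff.2 fun V hV => ?_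
      obtain ⟨U, hU, hUV⟩ := mem_comap.1 (h hV.1)
      obtain ⟨δ, hδ, hδU⟩ := mem_nhdsLT_iff_exists_Ioo_subset.1 hU
      filter_upwards [Ioo_mem_nhdsLT hδ] with a ha
      have hca : ContinuousAt (fun a => F a ξ) a := by
        have h1 : ContinuousAt (fun a => g.toFun (p a ξ)) a :=
          ContinuousAt.comp (f := fun a : ℝ => p a ξ) (g := g.toFun)
            (g.holo.continuousOn.continuousAt
              ((isOpen_lt Complex.continuous_re continuous_const).mem_nhds
                (by simpa [hp] using ha.2)))
            (by fun_prop)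
        refine h1.congr ?_
        filter_upwards [Iio_mem_nhds ha.2] with b hb
        exact (if_pos hb).symm
      have hcl : a ∈ closure (Ioo δ 0 ∩ range ((↑) : ℚ → ℝ)) :=
        (Rat.isDenseEmbedding_coe_real.dense.open_subset_closure_inter isOpen_Ioo) ha
      have := hca.continuousWithinAt.mem_closure hcl
        (t := V) (by rintro _ ⟨hb, q, rfl⟩; exact hUV (hδU hb))
      rwa [hV.2.closure_eq] at this
    rw [hSL]
    exact measurableSet_exists_tendsto fun q => (hF q).measurable
  have hb : ∀ ξ ∈ S, Tendsto (fun a => F a ξ) (𝓝[<] 0) (𝓝 (g.boundary ξ)) := fun ξ hξ => by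
    have h : ∃ l, Tendsto (fun a => g.toFun (p a ξ)) (𝓝[<] 0) (𝓝 l) :=
      hξ.imp fun l hl => hl.congr' (hFg ξ)
    have h2 : g.boundary ξ = limUnder (𝓝[<] 0) fun a => g.toFun (p a ξ) := if_pos h
    rw [h2]
    exact (tendsto_nhds_limUnder h).congr' (hFg ξ).symm
  have hb' : ∀ ξ ∉ S, g.boundary ξ = 0 := fun ξ hξ =>
    if_neg fun h => hξ (h.imp fun l hl => hl.congr' (hFg ξ).symm)
  have hlim : ∀ ξ, Tendsto (fun a => S.indicator (F a) ξ) (𝓝[<] 0) (𝓝 (g.boundary ξ)) := fun ξ => by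
    by_cases hξ : ξ ∈ S
    · simpa only [indicator_of_mem hξ] using hb ξ hξ
    · simpa only [indicator_of_notMem hξ, hb' ξ hξ] using tendsto_const_nhds
  refine memLp_top_of_bound (stronglyMeasurable_of_tendsto (𝓝[<] 0)
    (fun a => (hF a).indicator hS) (tendsto_pi_nhds.2 hlim)).aestronglyMeasurable C ?_
  refine Eventually.of_forall fun ξ => le_of_tendsto (hlim ξ).norm (Eventually.of_forall fun a => ?_)
  refine (norm_indicator_le_norm_self _ _).trans ?_
  by_cases ha : a < 0
  · simpa only [F, if_pos ha] using hC _ (by rw [hp]; exact ha)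
  · simpa only [F, if_neg ha, norm_zero] using hC0

/-- The boundary function of `g` as an essentially bounded function. -/
def boundaryLp : Lp ℂ ∞ (volume : Measure ℝ) := g.memLp_boundary.toLp _

/-- The Toeplitz operator `M_g f = 𝔏⁻¹ Π (g · 𝔏 f)` on `L²(0,∞)`, where `Π` is the orthogonal
projection of `L²(iℝ)` onto `H²`. -/
def toeplitz (f : L2pos) : L2pos :=
  laplaceEquiv.symm (hardy.orthogonalProjectionOnto (g.boundaryLp • laplace f : L2line))

end HInfLeft

/-! ### Weakly admissible output mappings and the calculus -/

section Calculus

variable {X : Type*} [NormedAddCommGroup X] [NormedSpace ℂ X] (T : C0Semigroup X)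
  {Z : Type*} [NormedAddCommGroup Z] [NormedSpace ℂ Z]

/-- A bounded bilinear map `B : X × Z → L²(0,∞)` is a weakly admissible output mapping for `T(·)`
if `B(x,y)(· + τ) = B(T(τ)x,y)` for all `τ > 0`. -/
def WeaklyAdmissible (B : X →L[ℂ] Z →L[ℂ] L2pos) : Prop :=
  ∀ τ : ℝ≥0, 0 < τ → ∀ (x : X) (y : Z),
    ∀ᵐ t ∂(volume.restrict (Ioi (0 : ℝ))), B x y (t + τ) = B (T.op τ x) y t

/-- The output mapping `𝔇_{g,y} x = M_g (B(x,y))`. -/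
def outputMap (B : X →L[ℂ] Z →L[ℂ] L2pos) (g : HInfLeft) (y : Z) (x : X) : L2pos :=
  g.toeplitz (B x y)

/-- The bounded operator `G : X₁ → Z'` satisfies `𝔇_{g,y} x₁ = ⟨y, G T(·) x₁⟩` in `L²(0,∞)` for all
`y ∈ Z` and `x₁ ∈ D(A)`. -/
def IsCalculusOp (B : X →L[ℂ] Z →L[ℂ] L2pos) (g : HInfLeft)
    (G : T.X1 →L[ℂ] StrongDual ℂ Z) : Prop :=
  ∀ (y : Z) (x₁ : T.X1), ∀ᵐ t ∂(volume.restrict (Ioi (0 : ℝ))),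
    outputMap B g y (T.incl x₁) t = G (T.onX1 t.toNNReal x₁) y

/-- `B(x,y) = ⟨y, T(·)x⟩` on `X × X'`. -/
def IsOrbitOutput (B : X →L[ℂ] StrongDual ℂ X →L[ℂ] L2pos) : Prop :=
  ∀ (x : X) (y : StrongDual ℂ X), ∀ᵐ t ∂(volume.restrict (Ioi (0 : ℝ))),
    B x y t = y (T.op t.toNNReal x)

end Calculus

end

/-!
The theorem rests on two facts.

*The Toeplitz operators `M_g` commute with the left shifts of `L²(0,∞)`*
(`HInfLeft.toeplitz_leftShift`). The exponentials `e_s(t) = exp(-st)`, `Re s > 0`, are total in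
`L²(0,∞)` (`eq_zero_of_inner_expL2`), the left shift by `τ` multiplies `e_s` by `exp(-sτ)`, and the
Laplace transforms of `e_s` and of its right shifts are explicit. Tested on exponentials, the
commutation relation says that
`∫ g(z) (exp(zτ) - exp(-sτ)) / ((s + z) (μ - z)) dz = 0` along the imaginary axis. The integrand is
bounded holomorphic in the left half-plane (the singularity at `z = -s` is removable) and decays
like `|z|⁻²`, so Cauchy's theorem applies on vertical lines `Re z = a < 0`; then `a → 0`. The last
step needs Fatou's theorem, that `g` has horizontal boundary limits almost everywhere
(`ae_exists_tendsto_horizontal`): a primitive `G` of `g` is Lipschitz, so its boundary function is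
differentiable almost everywhere by Rademacher's theorem, and a Poisson-type formula for `G'`
(`deriv_neg_one_mul_integral`), applied to rescalings of `G`, turns this into convergence of `g`.

*A weakly admissible output mapping is given by an observation operator*
(`ae_eq_observation`, Weiss's representation theorem). Since `(x, y) ↦ M_g (B(x, y))` is again
weakly admissible, it is enough to represent an arbitrary `B`. For every `s` with `Re s > 0` the
operator `C x y = ∫₀^∞ exp(-st) B((s - A)x, y)(t) dt` does it: this follows from the formula
`(s - A)⁻¹ u = ∫₀^∞ exp(-sr) T(r)u dr` and Fubini's theorem. As an operator representing `B` is
unique, by continuity of `t ↦ T(t)x` in `X₁`, `C` does not depend on `s`.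

The four claims can then be read off from the formula
`g^B(A) x y = ∫₀^∞ exp(-st) M_g(B((s - A)x, y))(t) dt`. With `x` replaced by `(s - A)⁻¹ x` it gives
the resolvent estimate, as `‖e_s‖ ≤ (Re s)^(-1/2)`. The commutation with the semigroup is inherited
from `B`. For `B(x, y) = ⟨y, T(·)x⟩` the right-hand side is a bounded functional of
`B((s - A)x, y) ∈ L²(0,∞)`, that is, integration against some `k ∈ L²(0,∞)`; so it is
`⟨y, ∫₀^∞ k(t) T(t)(s - A)x dt⟩`, with a Bochner integral in `X`.
-/

noncomputable section

/-! ### Cauchy's theorem and boundary limits in the left half-plane -/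

/-- Cauchy's theorem for the left half-plane: the integral along the imaginary axis vanishes if the
function decays quadratically. The axis is closed up by the other three sides of the rectangle with
corners `-R ± iR` and `±iR`, whose contribution is `O(1/R)`. -/
theorem integral_imaginaryAxis_eq_zero {H : ℂ → ℂ} {K R₀ : ℝ}
    (hc : ContinuousOn H {z | z.re ≤ 0}) (hd : DifferentiableOn ℂ H {z | z.re < 0})
    (hK : ∀ z : ℂ, z.re ≤ 0 → R₀ ≤ ‖z‖ → ‖H z‖ ≤ K / ‖z‖ ^ 2)
    (hint : Integrable fun y : ℝ => H (y * Complex.I)) :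
    ∫ y : ℝ, H (y * Complex.I) = 0 := by
  have h1 : Tendsto (fun R : ℝ => ∫ y in (-R)..R, H (y * Complex.I)) atTop
      (𝓝 (∫ y : ℝ, H (y * Complex.I))) :=
    intervalIntegral_tendsto_integral hint tendsto_neg_atTop_atBot tendsto_id
  refine tendsto_nhds_unique h1 (squeeze_zero_norm' (a := fun R => 4 * |K| / R) ?_ ?_)
  swap
  · exact tendsto_const_nhds.div_atTop tendsto_id
  filter_upwards [eventually_ge_atTop R₀, eventually_gt_atTop 0] with R hR hR0
  have hb : ∀ z : ℂ, z.re ≤ 0 → R ≤ ‖z‖ → ‖H z‖ ≤ |K| / R ^ 2 := fun z hz hRz =>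
    (hK z hz (hR.trans hRz)).trans (by gcongr; exact le_abs_self K)
  have hrect := Complex.integral_boundary_rect_eq_zero_of_continuousOn_of_differentiableOn H
    (⟨-R, -R⟩ : ℂ) (⟨0, R⟩ : ℂ)
    (hc.mono fun z hz => by
      have := hz.1
      simp only [mem_preimage, uIcc_of_le (neg_nonpos.2 hR0.le)] at this
      exact this.2)
    (hd.mono fun z hz => by
      have := hz.1
      simp only [mem_preimage, max_eq_right (neg_nonpos.2 hR0.le)] at this
      exact this.2)
  simp only at hrect
  have e1 : ‖∫ x : ℝ in (-R)..0, H (x + ((-R : ℝ) : ℂ) * Complex.I)‖ ≤ |K| / R ^ 2 * R := by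
    refine (intervalIntegral.norm_integral_le_of_norm_le_const (C := |K| / R ^ 2)
      fun x hx => hb _ ?_ ?_).trans ?_
    · rw [uIoc_of_le (neg_nonpos.2 hR0.le)] at hx
      simpa using hx.2
    · refine le_trans ?_ (Complex.abs_im_le_norm _)
      simp [abs_of_pos hR0]
    · simp [abs_of_pos hR0]
  have e2 : ‖∫ x : ℝ in (-R)..0, H (x + (R : ℂ) * Complex.I)‖ ≤ |K| / R ^ 2 * R := by
    refine (intervalIntegral.norm_integral_le_of_norm_le_const (C := |K| / R ^ 2)
      fun x hx => hb _ ?_ ?_).trans ?_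
    · rw [uIoc_of_le (neg_nonpos.2 hR0.le)] at hx
      simpa using hx.2
    · refine le_trans ?_ (Complex.abs_im_le_norm _)
      simp [abs_of_pos hR0]
    · simp [abs_of_pos hR0]
  have e3 : ‖∫ y : ℝ in (-R)..R, H (((-R : ℝ) : ℂ) + y * Complex.I)‖ ≤ |K| / R ^ 2 * (2 * R) := by
    refine (intervalIntegral.norm_integral_le_of_norm_le_const (C := |K| / R ^ 2)
      fun x hx => hb _ ?_ ?_).trans ?_
    · simp [hR0.le]
    · refine le_trans ?_ (Complex.abs_re_le_norm _)
      simp [abs_of_pos hR0]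
    · rw [sub_neg_eq_add, ← two_mul, abs_of_pos (mul_pos two_pos hR0)]
  have h0 : Complex.I * ∫ y : ℝ in (-R)..R, H (y * Complex.I)
      = Complex.I * (∫ y : ℝ in (-R)..R, H (((-R : ℝ) : ℂ) + y * Complex.I))
        + (∫ x : ℝ in (-R)..0, H (x + (R : ℂ) * Complex.I))
        - ∫ x : ℝ in (-R)..0, H (x + ((-R : ℝ) : ℂ) * Complex.I) := by
    simp only [Complex.ofReal_zero, zero_add, smul_eq_mul] at hrect
    linear_combination hrect
  calc ‖∫ y : ℝ in (-R)..R, H (y * Complex.I)‖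
      = ‖Complex.I * ∫ y : ℝ in (-R)..R, H (y * Complex.I)‖ := by simp
    _ ≤ |K| / R ^ 2 * (2 * R) + |K| / R ^ 2 * R + |K| / R ^ 2 * R := by
        rw [h0]
        refine (norm_sub_le _ _).trans (add_le_add ((norm_add_le _ _).trans (add_le_add ?_ e2)) e1)
        simpa using e3
    _ = 4 * |K| / R := by field_simp; ring

theorem integral_eq_zero_of_odd {f : ℝ → ℂ} (hf : ∀ x, f (-x) = -f x) : ∫ x, f x = 0 := by
  have h := integral_neg_eq_self f volume
  simp only [hf, integral_neg] at h
  exact self_eq_neg.1 h.symm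

theorem continuous_div_one_add_sq_sq : Continuous fun u : ℝ => u / (1 + u ^ 2) ^ 2 :=
  continuous_id.div (by fun_prop) fun u => by positivity

theorem continuous_sq_div_one_add_sq_sq : Continuous fun u : ℝ => u ^ 2 / (1 + u ^ 2) ^ 2 :=
  (continuous_id.pow 2).div (by fun_prop) fun u => by positivity

theorem integrable_sq_div_one_add_sq_sq : Integrable fun u : ℝ => u ^ 2 / (1 + u ^ 2) ^ 2 := by
  refine integrable_inv_one_add_sq.mono'
    continuous_sq_div_one_add_sq_sq.aestronglyMeasurable (Eventually.of_forall fun u => ?_)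
  rw [Real.norm_of_nonneg (by positivity), div_le_iff₀ (by positivity)]
  have : (1 + u ^ 2)⁻¹ * (1 + u ^ 2) ^ 2 = 1 + u ^ 2 := by field_simp
  rw [this]; linarith

theorem integral_sq_div_one_add_sq_sq_pos : 0 < ∫ u : ℝ, u ^ 2 / (1 + u ^ 2) ^ 2 := by
  refine integral_pos_of_integrable_nonneg_nonzero (x := 1) ?_ integrable_sq_div_one_add_sq_sq
    (fun u => by positivity) (by norm_num)
  exact continuous_sq_div_one_add_sq_sq

/-- A Poisson-type formula for the derivative at `-1` of a Lipschitz function, in terms of its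
values on the imaginary axis. One factor more of decay than in Cauchy's formula makes the integral
converge absolutely for functions of linear growth. -/
theorem deriv_neg_one_mul_integral {F : ℂ → ℂ} {K : ℝ≥0} (hF : LipschitzWith K F) (hF0 : F 0 = 0)
    (hd : DifferentiableOn ℂ F {z | z.re < 0}) :
    deriv F (-1) * ∫ u : ℝ, ((u ^ 2 / (1 + u ^ 2) ^ 2 : ℝ) : ℂ) =
      -Complex.I * ∫ u : ℝ, ((u / (1 + u ^ 2) ^ 2 : ℝ) : ℂ) * F (u * Complex.I) := by
  have hopen : IsOpen {z : ℂ | z.re < 0} := isOpen_lt Complex.continuous_re continuous_const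
  have hm1 : {z : ℂ | z.re < 0} ∈ 𝓝 (-1 : ℂ) := hopen.mem_nhds (by simp)
  have hm1' : {z : ℂ | z.re ≤ 0} ∈ 𝓝 (-1 : ℂ) := mem_of_superset hm1 fun z (hz : z.re < 0) => hz.le
  -- `D` is the quotient of `F z - F (-1) - F' (-1) (z + 1)` by `(z + 1)²`, holomorphic at `-1` too;
  -- Cauchy's theorem is applied to `z D(z) / (1 - z)²`.
  set D := dslope (dslope F (-1)) (-1) with hD
  have hd1 : DifferentiableOn ℂ (dslope F (-1)) {z | z.re < 0} :=
    (Complex.differentiableOn_dslope hm1).2 hd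
  have hd2 : DifferentiableOn ℂ D {z | z.re < 0} := (Complex.differentiableOn_dslope hm1).2 hd1
  have hc1 : ContinuousOn (dslope F (-1)) {z | z.re ≤ 0} :=
    (continuousOn_dslope hm1').2 ⟨hF.continuous.continuousOn, hd.differentiableAt hm1⟩
  have hc2 : ContinuousOn D {z | z.re ≤ 0} :=
    (continuousOn_dslope hm1').2 ⟨hc1, hd1.differentiableAt hm1⟩
  have hDv : ∀ z : ℂ, z ≠ -1 →
      D z = (F z - F (-1) - deriv F (-1) * (z + 1)) / (z + 1) ^ 2 := fun z hz => by
    have hz1 : z + 1 ≠ 0 := fun h => hz (eq_neg_of_add_eq_zero_left h)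
    rw [hD, dslope_of_ne _ hz, slope_def_field, dslope_of_ne _ hz, dslope_same, slope_def_field,
      sub_neg_eq_add]
    field_simp
  have hFn : ∀ z : ℂ, ‖F z‖ ≤ K * ‖z‖ := fun z => by
    simpa [hF0] using hF.norm_sub_le z 0
  have hne : ∀ u : ℝ, (u : ℂ) * Complex.I ≠ -1 := fun u h => by
    have := congrArg Complex.re h
    simp at this
  have hint1 : Integrable fun u : ℝ => ((u / (1 + u ^ 2) ^ 2 : ℝ) : ℂ) := by
    refine Integrable.ofReal (f := fun u : ℝ => u / (1 + u ^ 2) ^ 2)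
      (integrable_inv_one_add_sq.mono' continuous_div_one_add_sq_sq.aestronglyMeasurable
        (Eventually.of_forall fun u => ?_))
    rw [norm_div, Real.norm_of_nonneg (show (0 : ℝ) ≤ (1 + u ^ 2) ^ 2 by positivity),
      div_le_iff₀ (by positivity), Real.norm_eq_abs]
    have : (1 + u ^ 2)⁻¹ * (1 + u ^ 2) ^ 2 = 1 + u ^ 2 := by field_simp
    rw [this]
    nlinarith [sq_nonneg (|u| - 1), sq_abs u, abs_nonneg u]
  have hint2 : Integrable fun u : ℝ => ((u / (1 + u ^ 2) ^ 2 : ℝ) : ℂ) * F (u * Complex.I) := by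
    refine (integrable_sq_div_one_add_sq_sq.const_mul (K : ℝ)).mono' ?_
      (Eventually.of_forall fun u => ?_)
    · refine AEStronglyMeasurable.mul
        (Complex.continuous_ofReal.comp continuous_div_one_add_sq_sq).aestronglyMeasurable ?_
      exact (hF.continuous.comp
        (by fun_prop : Continuous fun u : ℝ => (u : ℂ) * Complex.I)).aestronglyMeasurable
    · rw [norm_mul, Complex.norm_real, norm_div,
        Real.norm_of_nonneg (show (0 : ℝ) ≤ (1 + u ^ 2) ^ 2 by positivity)]
      have h := hFn (u * Complex.I)
      rw [norm_mul, Complex.norm_I, mul_one, Complex.norm_real] at h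
      calc ‖u‖ / (1 + u ^ 2) ^ 2 * ‖F (u * Complex.I)‖
          ≤ ‖u‖ / (1 + u ^ 2) ^ 2 * (K * ‖u‖) := by gcongr
        _ = K * (u ^ 2 / (1 + u ^ 2) ^ 2) := by
          rw [← sq_abs u, ← Real.norm_eq_abs]; ring
  have hint3 : Integrable fun u : ℝ => ((u ^ 2 / (1 + u ^ 2) ^ 2 : ℝ) : ℂ) :=
    Integrable.ofReal integrable_sq_div_one_add_sq_sq
  have hval : ∀ u : ℝ, (u * Complex.I) * D (u * Complex.I) / (1 - u * Complex.I) ^ 2 =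
      Complex.I * (((u / (1 + u ^ 2) ^ 2 : ℝ) : ℂ) * F (u * Complex.I)) -
      Complex.I * (F (-1) + deriv F (-1)) * ((u / (1 + u ^ 2) ^ 2 : ℝ) : ℂ) +
      deriv F (-1) * ((u ^ 2 / (1 + u ^ 2) ^ 2 : ℝ) : ℂ) := fun u => by
    rw [hDv _ (hne u)]
    have h1 : (1 + (u : ℂ) ^ 2) ≠ 0 := by
      have : (0 : ℝ) < 1 + u ^ 2 := by positivity
      exact_mod_cast this.ne'
    have h2 : (1 + (u : ℂ) ^ 2) = (u * Complex.I + 1) * (1 - u * Complex.I) := by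
      linear_combination ((u : ℂ) ^ 2) * Complex.I_sq
    have h3 : (u * Complex.I + 1) ≠ 0 := left_ne_zero_of_mul (h2 ▸ h1)
    have h4 : (1 - u * Complex.I) ≠ 0 := right_ne_zero_of_mul (h2 ▸ h1)
    push_cast
    rw [h2]
    field_simp
    linear_combination (-(u : ℂ) ^ 2 * deriv F (-1)) * Complex.I_sq
  have hV := integral_imaginaryAxis_eq_zero (H := fun z => z * D z / (1 - z) ^ 2) (R₀ := 2)
    (K := 4 * (K + ‖F (-1)‖ + 2 * ‖deriv F (-1)‖)) ?_ ?_ ?_ ?_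
  · simp only [hval] at hV
    rw [integral_add (f := fun u : ℝ => Complex.I * (((u / (1 + u ^ 2) ^ 2 : ℝ) : ℂ) *
        F (u * Complex.I)) - Complex.I * (F (-1) + deriv F (-1)) * ((u / (1 + u ^ 2) ^ 2 : ℝ) : ℂ))
        ((hint2.const_mul _).sub (hint1.const_mul _)) (hint3.const_mul _),
      integral_sub (hint2.const_mul _) (hint1.const_mul _), integral_const_mul, integral_const_mul,
      integral_const_mul,
      integral_eq_zero_of_odd (f := fun u : ℝ => ((u / (1 + u ^ 2) ^ 2 : ℝ) : ℂ))]
      at hV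
    · linear_combination hV
    · intro u
      push_cast; ring
  · refine (continuousOn_id.mul hc2).div (by fun_prop) fun z hz => ?_
    refine pow_ne_zero _ fun h => ?_
    rw [← sub_eq_zero.1 h] at hz
    norm_num at hz
  · refine (differentiableOn_id.mul hd2).div (by fun_prop) fun z hz => ?_
    refine pow_ne_zero _ fun h => ?_
    rw [← sub_eq_zero.1 h] at hz
    norm_num at hz
  · intro z hz h2
    have hz1 : z ≠ -1 := by rintro rfl; norm_num at h2
    simp only [hDv z hz1]
    have hn0 : 0 < ‖z‖ := by linarith
    have ha : ‖z‖ / 2 ≤ ‖z + 1‖ := by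
      have := norm_sub_le (z + 1) 1
      simp at this
      linarith
    have hb : ‖z‖ ≤ ‖1 - z‖ := by
      rw [← sq_le_sq₀ (norm_nonneg _) (norm_nonneg _), ← Complex.normSq_eq_norm_sq,
        ← Complex.normSq_eq_norm_sq, Complex.normSq_apply, Complex.normSq_apply]
      simp
      nlinarith
    have hnum : ‖F z - F (-1) - deriv F (-1) * (z + 1)‖ ≤
        (K + ‖F (-1)‖ + 2 * ‖deriv F (-1)‖) * ‖z‖ := by
      have h3 := norm_sub_le (F z - F (-1)) (deriv F (-1) * (z + 1))
      have h4 := norm_sub_le (F z) (F (-1))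
      have h5 : ‖deriv F (-1) * (z + 1)‖ ≤ ‖deriv F (-1)‖ * (2 * ‖z‖) := by
        rw [norm_mul]
        gcongr
        have := norm_add_le z 1
        simp at this
        linarith
      have h6 : ‖F (-1)‖ ≤ ‖F (-1)‖ * ‖z‖ := le_mul_of_one_le_right (norm_nonneg _) (by linarith)
      nlinarith [hFn z]
    rw [norm_div, norm_mul, norm_div, norm_pow, norm_pow]
    calc ‖z‖ * (‖F z - F (-1) - deriv F (-1) * (z + 1)‖ / ‖z + 1‖ ^ 2) / ‖1 - z‖ ^ 2
        ≤ ‖z‖ * ((K + ‖F (-1)‖ + 2 * ‖deriv F (-1)‖) * ‖z‖ / (‖z‖ / 2) ^ 2) / ‖z‖ ^ 2 := by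
          gcongr
      _ = 4 * (K + ‖F (-1)‖ + 2 * ‖deriv F (-1)‖) / ‖z‖ ^ 2 := by field_simp; ring
  · simp only [hval]
    exact ((hint2.const_mul _).sub (hint1.const_mul _)).add (hint3.const_mul _)

/-- Fatou's theorem for the left half-plane: a bounded holomorphic function has horizontal limits at
almost every point of the imaginary axis. -/
theorem ae_exists_tendsto_horizontal {g : ℂ → ℂ} {C : ℝ} (hg : DifferentiableOn ℂ g {z | z.re < 0})
    (hC : ∀ z : ℂ, z.re < 0 → ‖g z‖ ≤ C) :
    ∀ᵐ ξ : ℝ, ∃ l : ℂ,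
      Tendsto (fun a : ℝ => g (a + 2 * Real.pi * ξ * Complex.I)) (𝓝[<] 0) (𝓝 l) := by
  have hC0 : 0 ≤ C := (norm_nonneg _).trans (hC (-1) (by simp))
  have hopen : IsOpen {z : ℂ | z.re < 0} := isOpen_lt Complex.continuous_re continuous_const
  have hconv : Convex ℝ {z : ℂ | z.re < 0} := convex_halfSpace_re_lt 0
  obtain ⟨G₀, hG₀⟩ := hconv.exists_forall_hasDerivWithinAt hg
  have hlip : LipschitzOnWith C.toNNReal G₀ {z : ℂ | z.re < 0} :=
    hconv.lipschitzOnWith_of_nnnorm_hasDerivWithin_le hG₀ fun z hz => by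
      rw [← NNReal.coe_le_coe, coe_nnnorm, Real.coe_toNNReal _ hC0]
      exact hC z hz
  obtain ⟨G, hGl, hGe⟩ := hlip.extend_finite_dimension
  set K := lipschitzExtensionConstant ℂ * C.toNNReal
  have hG : ∀ z : ℂ, z.re < 0 → HasDerivAt G (g z) z := fun z hz =>
    (((hG₀ z hz).congr (fun w hw => (hGe hw).symm) (hGe hz).symm).hasDerivAt (hopen.mem_nhds hz))
  have hψ : LipschitzWith (K * (2 * Real.pi).toNNReal)
      fun ξ : ℝ => G (2 * Real.pi * ξ * Complex.I) := by
    refine hGl.comp (LipschitzWith.of_dist_le_mul fun x y => le_of_eq ?_)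
    rw [dist_eq_norm, dist_eq_norm, Real.coe_toNNReal _ (by positivity),
      show (2 * Real.pi * x * Complex.I - 2 * Real.pi * y * Complex.I : ℂ) =
        ((2 * Real.pi : ℝ) : ℂ) * ((x - y : ℝ) : ℂ) * Complex.I by push_cast; ring,
      norm_mul, norm_mul, Complex.norm_I, mul_one, Complex.norm_real, Complex.norm_real,
      Real.norm_of_nonneg (by positivity)]
  filter_upwards [hψ.ae_differentiableAt_real] with ξ hξ
  set p : ℂ := 2 * Real.pi * ξ * Complex.I with hp
  have hpre : p.re = 0 := by simp [hp]
  -- the rescaled functions `z ↦ (G (p - a z) - G p) / (-a)` become linear on the imaginary axis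
  obtain ⟨c, hc⟩ : ∃ c : ℂ, ∀ u : ℝ, Tendsto
      (fun a : ℝ => (-a : ℂ)⁻¹ * (G (p + -a * (u * Complex.I)) - G p)) (𝓝[<] 0) (𝓝 (u * c)) := by
    set c₁ := deriv (fun ξ : ℝ => G (2 * Real.pi * ξ * Complex.I)) ξ
    refine ⟨(2 * Real.pi)⁻¹ * c₁, fun u => ?_⟩
    have h1 : HasDerivAt (fun s : ℝ => ξ + s * (-(u / (2 * Real.pi))))
        (-(u / (2 * Real.pi))) 0 := by
      simpa using ((hasDerivAt_id (0 : ℝ)).mul_const (-(u / (2 * Real.pi)))).const_add ξ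
    have h2 : HasDerivAt (fun ξ : ℝ => G (2 * Real.pi * ξ * Complex.I)) c₁
        (ξ + 0 * (-(u / (2 * Real.pi)))) := by
      rw [zero_mul, add_zero]; exact hξ.hasDerivAt
    have h3 := (h2.scomp (0 : ℝ) h1).tendsto_slope
    have h4 := (h3.mono_left (nhdsLT_le_nhdsNE 0)).neg
    refine (h4.congr' ?_).trans_eq ?_
    · filter_upwards [self_mem_nhdsWithin] with a ha
      have hpi : (Real.pi : ℂ) ≠ 0 := by exact_mod_cast Real.pi_ne_zero
      rw [slope_def_module]
      simp only [Function.comp_apply, sub_zero, zero_mul, add_zero]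
      rw [show (2 * Real.pi * ((ξ + a * (-(u / (2 * Real.pi))) : ℝ) : ℂ) * Complex.I) =
        p + -a * (u * Complex.I) by push_cast; rw [hp]; field_simp, Complex.real_smul]
      push_cast
      rw [← hp, inv_neg, neg_mul, neg_mul]
    · rw [Complex.real_smul]; push_cast; congr 1; ring
  set J : ℂ := ∫ u : ℝ, ((u ^ 2 / (1 + u ^ 2) ^ 2 : ℝ) : ℂ) with hJ
  have hJ0 : J ≠ 0 := by
    rw [hJ, integral_complex_ofReal]
    exact Complex.ofReal_ne_zero.2 integral_sq_div_one_add_sq_sq_pos.ne'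
  have hFl : ∀ a : ℝ, a < 0 →
      LipschitzWith K fun z : ℂ => (-a : ℂ)⁻¹ * (G (p + -a * z) - G p) := fun a ha => by
    refine LipschitzWith.of_dist_le_mul fun z w => ?_
    have h := hGl.norm_sub_le (p + -a * z) (p + -a * w)
    rw [dist_eq_norm, dist_eq_norm, ← mul_sub, sub_sub_sub_cancel_right, norm_mul, norm_inv,
      norm_neg]
    rw [add_sub_add_left_eq_sub, ← mul_sub, norm_mul, norm_neg] at h
    have hna : 0 < ‖(a : ℂ)‖ := by simpa using ha.ne
    calc ‖(a : ℂ)‖⁻¹ * ‖G (p + -a * z) - G (p + -a * w)‖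
        ≤ ‖(a : ℂ)‖⁻¹ * (K * (‖(a : ℂ)‖ * ‖z - w‖)) := by gcongr
      _ = K * ‖z - w‖ := by field_simp
  -- the derivative at `-1` of the rescaled function is the value of `g` at `p + a`
  have hmain : ∀ a : ℝ, a < 0 → g (a + p) = J⁻¹ * (-Complex.I * ∫ u : ℝ,
      ((u / (1 + u ^ 2) ^ 2 : ℝ) : ℂ) *
        ((-a : ℂ)⁻¹ * (G (p + -a * (u * Complex.I)) - G p))) := fun a ha => by
    have ha0 : (-a : ℂ) ≠ 0 := by simpa using ha.ne
    have hder : ∀ z : ℂ, z.re < 0 →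
        HasDerivAt (fun z : ℂ => (-a : ℂ)⁻¹ * (G (p + -a * z) - G p)) (g (p + -a * z)) z :=
      fun z hz => by
        have h1 : HasDerivAt (fun z : ℂ => p + -a * z) (-a : ℂ) z := by
          simpa using ((hasDerivAt_id z).const_mul (-a : ℂ)).const_add p
        have h2 := hG (p + -a * z) (by
          simp only [Complex.add_re, hpre, neg_mul, Complex.neg_re, Complex.re_ofReal_mul]
          nlinarith)
        have h3 := ((h2.comp z h1).sub_const (G p)).const_mul (-a : ℂ)⁻¹
        convert! h3 using 1
        rw [mul_comm (g _), inv_mul_cancel_left₀ ha0]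
    have h := deriv_neg_one_mul_integral (hFl a ha) (by simp)
      (fun z hz => (hder z hz).differentiableAt.differentiableWithinAt)
    rw [(hder (-1) (by simp)).deriv, ← hJ] at h
    rw [← h, show p + -a * -1 = a + p by ring]
    field_simp
  refine ⟨J⁻¹ * (-Complex.I * ∫ u : ℝ, ((u / (1 + u ^ 2) ^ 2 : ℝ) : ℂ) * (u * c)), ?_⟩
  refine Tendsto.congr' (f₁ := fun a : ℝ => J⁻¹ * (-Complex.I * ∫ u : ℝ,
      ((u / (1 + u ^ 2) ^ 2 : ℝ) : ℂ) *
        ((-a : ℂ)⁻¹ * (G (p + -a * (u * Complex.I)) - G p)))) ?_ ?_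
  · filter_upwards [self_mem_nhdsWithin] with a ha using (hmain a ha).symm
  refine Tendsto.const_mul _ (Tendsto.const_mul _ ?_)
  refine tendsto_integral_filter_of_dominated_convergence
    (fun u => K * (u ^ 2 / (1 + u ^ 2) ^ 2)) ?_ ?_ (integrable_sq_div_one_add_sq_sq.const_mul _) ?_
  · refine Eventually.of_forall fun a => AEStronglyMeasurable.mul
        (Complex.continuous_ofReal.comp continuous_div_one_add_sq_sq).aestronglyMeasurable ?_
    have := hGl.continuous
    exact Continuous.aestronglyMeasurable (by fun_prop)
  · filter_upwards [self_mem_nhdsWithin] with a ha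
    refine Eventually.of_forall fun u => ?_
    have h := (hFl a ha).norm_sub_le (u * Complex.I) 0
    simp only [mul_zero, add_zero, sub_self, sub_zero, norm_mul, Complex.norm_I, mul_one,
      Complex.norm_real] at h
    rw [norm_mul, norm_mul, Complex.norm_real, norm_div,
      Real.norm_of_nonneg (show (0 : ℝ) ≤ (1 + u ^ 2) ^ 2 by positivity)]
    calc ‖u‖ / (1 + u ^ 2) ^ 2 * (‖(-a : ℂ)⁻¹‖ * ‖G (p + -a * (u * Complex.I)) - G p‖)
        ≤ ‖u‖ / (1 + u ^ 2) ^ 2 * (K * ‖u‖) := by gcongr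
      _ = K * (u ^ 2 / (1 + u ^ 2) ^ 2) := by
        rw [← sq_abs u, ← Real.norm_eq_abs]; ring
  · exact Eventually.of_forall fun u => (hc u).const_mul _

/-! ### Exponentials in `L²(0,∞)` and their Laplace transforms -/

/-- On `L¹ ∩ L²` the Fourier transform of `L²(ℝ)` is given by the Fourier integral: both are the
Fourier transform in the sense of tempered distributions. -/
theorem fourierTransform_toLp_ae_eq {f : ℝ → ℂ} (h1 : Integrable f) (h2 : MemLp f 2 volume) :
    (Lp.fourierTransformₗᵢ ℝ ℂ (h2.toLp f) : ℝ → ℂ) =ᵐ[volume] 𝓕 f := by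
  have hcont : Continuous (𝓕 f) :=
    VectorFourier.fourierIntegral_continuous Real.continuous_fourierChar
      (innerSL ℝ).continuous₂ h1
  refine ae_eq_of_integral_contDiff_smul_eq ((Lp.memLp _).locallyIntegrable (by norm_num))
    hcont.locallyIntegrable fun φ hφ hφc => ?_
  have hg₁ : HasCompactSupport (Complex.ofRealCLM ∘ φ) := hφc.comp_left rfl
  have hg₂ : ContDiff ℝ (⊤ : ℕ∞) (Complex.ofRealCLM ∘ φ) := by fun_prop
  set ψ := hg₁.toSchwartzMap hg₂ with hψ
  have hψx : ∀ x, ψ x = (φ x : ℂ) := fun x => rfl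
  have e1 : ∫ x, φ x • (Lp.fourierTransformₗᵢ ℝ ℂ (h2.toLp f) : ℝ → ℂ) x =
      Lp.toTemperedDistribution (Lp.fourierTransformₗᵢ ℝ ℂ (h2.toLp f)) ψ := by
    rw [Lp.toTemperedDistribution_apply]
    simp only [hψx, Complex.real_smul, smul_eq_mul]
  have e2 : Lp.toTemperedDistribution (Lp.fourierTransformₗᵢ ℝ ℂ (h2.toLp f)) ψ =
      Lp.toTemperedDistribution (h2.toLp f) (𝓕 ψ) := by
    have := Lp.fourier_toTemperedDistribution_eq (h2.toLp f)
    rw [← TemperedDistribution.fourier_apply, this]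
    rfl
  have e3 := VectorFourier.integral_fourierIntegral_smul_eq_flip (L := innerₗ ℝ) (f := ψ)
    (μ := volume) (ν := volume)
    Real.continuous_fourierChar continuous_inner (ψ.integrable (μ := volume)) h1
  rw [e1, e2, Lp.toTemperedDistribution_apply]
  calc ∫ x, (𝓕 ψ) x • (h2.toLp f : ℝ → ℂ) x = ∫ x, (𝓕 ψ) x • f x := by
        refine integral_congr_ae ?_
        filter_upwards [h2.coeFn_toLp] with x hx
        rw [hx]
    _ = ∫ x, ψ x • 𝓕 f x := by
        rw [SchwartzMap.fourier_coe]
        simpa using! e3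
    _ = ∫ x, φ x • 𝓕 f x := by simp only [hψx, Complex.real_smul, smul_eq_mul]

/-- The function `t ↦ exp(-s(t - τ))` on `(τ, ∞)`, extended by zero: the exponential `exp(-st)` on
`(0, ∞)`, shifted to the right by `τ`. -/
def shiftedExp (s : ℂ) (τ : ℝ) : ℝ → ℂ :=
  (Ioi τ).indicator fun t => Complex.exp (-s * (t - τ))

theorem norm_exp_neg_mul (s : ℂ) (t : ℝ) : ‖Complex.exp (-s * t)‖ = Real.exp (-s.re * t) := by
  rw [Complex.norm_exp]; simp

theorem integrable_shiftedExp {s : ℂ} (hs : 0 < s.re) (τ : ℝ) : Integrable (shiftedExp s τ) := by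
  refine (integrable_indicator_iff measurableSet_Ioi).2 ?_
  have h := (integrableOn_exp_mul_complex_Ioi (a := -s) (by simpa using hs) τ).const_mul
    (Complex.exp (s * τ))
  refine h.congr (Eventually.of_forall fun t => ?_)
  simp only [← Complex.exp_add]
  congr 1; ring

theorem memLp_shiftedExp {s : ℂ} (hs : 0 < s.re) (τ : ℝ) : MemLp (shiftedExp s τ) 2 volume := by
  rw [memLp_two_iff_integrable_sq_norm (integrable_shiftedExp hs τ).aestronglyMeasurable]
  have h2s : 0 < (2 * s).re := by simpa using hs
  refine (integrable_shiftedExp h2s τ).norm.congr (Eventually.of_forall fun t => ?_)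
  by_cases ht : t ∈ Ioi τ
  · simp only [shiftedExp, indicator_of_mem ht, ← norm_pow, ← Complex.exp_nat_mul]
    congr 2
    push_cast; ring
  · simp [shiftedExp, indicator_of_notMem ht]

theorem fourier_shiftedExp {s : ℂ} (hs : 0 < s.re) (τ : ℝ) (ξ : ℝ) :
    𝓕 (shiftedExp s τ) ξ =
      Complex.exp (-(2 * Real.pi * ξ * Complex.I) * τ) / (s + 2 * Real.pi * ξ * Complex.I) := by
  rw [Real.fourier_real_eq_integral_exp_smul]
  have hre : 0 < (s + 2 * Real.pi * ξ * Complex.I).re := by simpa using hs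
  have h1 : ∀ v : ℝ, Complex.exp (((-2 * Real.pi * v * ξ : ℝ) : ℂ) * Complex.I) • shiftedExp s τ v =
      (Ioi τ).indicator (fun v : ℝ => Complex.exp (s * τ) *
        Complex.exp (-(s + 2 * Real.pi * ξ * Complex.I) * v)) v := fun v => by
    by_cases hv : v ∈ Ioi τ
    · simp only [shiftedExp, indicator_of_mem hv, smul_eq_mul, ← Complex.exp_add]
      congr 1; push_cast; ring
    · simp [shiftedExp, indicator_of_notMem hv]
  simp_rw [h1]
  rw [integral_indicator measurableSet_Ioi, integral_const_mul,
    integral_exp_mul_complex_Ioi (by simpa using hs)]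
  rw [neg_div_neg_eq, mul_div_assoc', ← Complex.exp_add]
  congr 2; ring

theorem memLp_shiftedExp_restrict {s : ℂ} (hs : 0 < s.re) (τ : ℝ) :
    MemLp (shiftedExp s τ) 2 (volume.restrict (Ioi (0 : ℝ))) :=
  (memLp_shiftedExp hs τ).restrict _

/-- The right shift by `τ` of the exponential `exp(-st)`, as an element of `L²(0,∞)`. -/
def shiftedExpL2 (s : ℂ) (hs : 0 < s.re) (τ : ℝ) : L2pos :=
  (memLp_shiftedExp_restrict hs τ).toLp _

theorem laplace_ae_eq_fourier {f : L2pos} {k : ℝ → ℂ} (hk : Integrable k)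
    (hf : (Ioi (0 : ℝ)).indicator f =ᵐ[volume] k) : laplace f =ᵐ[volume] 𝓕 k := by
  have hk2 : MemLp k 2 volume := (memLp_congr_ae hf).1 (memLp_extend f)
  have h : laplace f = Lp.fourierTransformₗᵢ ℝ ℂ (hk2.toLp k) := by
    change Lp.fourierTransformₗᵢ ℝ ℂ ((memLp_extend f).toLp _) = _
    rw [(MemLp.toLp_eq_toLp_iff _ hk2).2 hf]
  rw [h]
  exact fourierTransform_toLp_ae_eq hk hk2

theorem laplace_shiftedExpL2 {s : ℂ} (hs : 0 < s.re) {τ : ℝ} (hτ : 0 ≤ τ) :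
    ∀ᵐ ξ : ℝ, laplace (shiftedExpL2 s hs τ) ξ =
      Complex.exp (-(2 * Real.pi * ξ * Complex.I) * τ) / (s + 2 * Real.pi * ξ * Complex.I) := by
  have h := laplace_ae_eq_fourier (f := shiftedExpL2 s hs τ) (integrable_shiftedExp hs τ) ?_
  · filter_upwards [h] with ξ hξ
    rw [hξ, fourier_shiftedExp hs]
  · filter_upwards [(ae_restrict_iff' measurableSet_Ioi).1
      (memLp_shiftedExp_restrict hs τ).coeFn_toLp] with t ht
    by_cases h0 : t ∈ Ioi (0 : ℝ)
    · rw [indicator_of_mem h0]; exact ht h0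
    · rw [indicator_of_notMem h0, shiftedExp, indicator_of_notMem]
      exact fun h1 => h0 (hτ.trans_lt h1)

/-- The exponential `t ↦ exp(-st)`, as an element of `L²(0,∞)`. -/
def expL2 (s : ℂ) (hs : 0 < s.re) : L2pos := shiftedExpL2 s hs 0

theorem expL2_ae {s : ℂ} (hs : 0 < s.re) :
    ∀ᵐ t ∂(volume.restrict (Ioi (0 : ℝ))), expL2 s hs t = Complex.exp (-s * t) := by
  filter_upwards [(memLp_shiftedExp_restrict hs 0).coeFn_toLp, ae_restrict_mem measurableSet_Ioi]
    with t ht h0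
  rw [expL2, shiftedExpL2, ht, shiftedExp, indicator_of_mem h0]
  simp

theorem conj_re_pos {s : ℂ} (hs : 0 < s.re) : 0 < (starRingEnd ℂ s).re := by simpa using hs

/-- Pairing `f` with a right shift of an exponential means pairing the left shift of `f` with the
exponential. -/
theorem inner_shiftedExpL2 {s : ℂ} (hs : 0 < s.re) {τ : ℝ} (hτ : 0 ≤ τ) (f : L2pos) :
    inner ℂ (shiftedExpL2 s hs τ) f =
      ∫ t in Ioi (0 : ℝ), Complex.exp (-(starRingEnd ℂ s) * t) * f (t + τ) := by
  rw [L2.inner_def]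
  have h1 : ∫ t in Ioi (0 : ℝ), inner ℂ (shiftedExpL2 s hs τ t) (f t) =
      ∫ t in Ioi (0 : ℝ), (Ioi τ).indicator
        (fun t : ℝ => Complex.exp (-(starRingEnd ℂ s) * (t - τ)) * f t) t := by
    refine integral_congr_ae ?_
    filter_upwards [(memLp_shiftedExp_restrict hs τ).coeFn_toLp] with t ht
    rw [shiftedExpL2, ht, RCLike.inner_apply, shiftedExp]
    by_cases h0 : t ∈ Ioi τ
    · rw [indicator_of_mem h0, indicator_of_mem h0, ← Complex.exp_conj, mul_comm]
      simp
    · simp [indicator_of_notMem h0]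
  rw [h1, integral_indicator measurableSet_Ioi, Measure.restrict_restrict measurableSet_Ioi,
    inter_eq_self_of_subset_left (Ioi_subset_Ioi hτ)]
  have h2 := (measurePreserving_add_right (volume : Measure ℝ) τ).setIntegral_preimage_emb
    (measurableEmbedding_addRight τ)
    (fun t : ℝ => Complex.exp (-(starRingEnd ℂ s) * (t - τ)) * f t) (Ioi τ)
  rw [← h2]
  simp

theorem inner_expL2 {s : ℂ} (hs : 0 < s.re) (f : L2pos) :
    inner ℂ (expL2 s hs) f = ∫ t in Ioi (0 : ℝ), Complex.exp (-(starRingEnd ℂ s) * t) * f t := by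
  simpa [expL2] using inner_shiftedExpL2 hs le_rfl f

theorem norm_expL2_le {s : ℂ} (hs : 0 < s.re) : ‖expL2 s hs‖ ≤ 1 / √s.re := by
  have h1 : ‖expL2 s hs‖ ^ 2 = 1 / (2 * s.re) := by
    have h2 : inner ℂ (expL2 s hs) (expL2 s hs) = ((1 / (2 * s.re) : ℝ) : ℂ) := by
      rw [inner_expL2]
      have h3 : ∫ t in Ioi (0 : ℝ), Complex.exp (-(starRingEnd ℂ s) * t) * expL2 s hs t =
          ∫ t in Ioi (0 : ℝ), Complex.exp (((-(2 * s.re) : ℝ) : ℂ) * t) := by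
        refine integral_congr_ae ?_
        filter_upwards [expL2_ae hs] with t ht
        rw [ht, ← Complex.exp_add, ← add_mul, ← neg_add, add_comm, Complex.add_conj]
        push_cast; rfl
      rw [h3, integral_exp_mul_complex_Ioi (by simpa using hs)]
      push_cast
      rw [mul_zero, Complex.exp_zero, neg_div_neg_eq]
    rw [inner_self_eq_norm_sq_to_K] at h2
    exact Complex.ofReal_injective (by simpa using h2)
  refine le_of_sq_le_sq ?_ (by positivity)
  rw [h1, div_pow, Real.sq_sqrt hs.le, one_pow]
  gcongr
  linarith

/-- The exponentials are total in `L²(0,∞)`: the inner products with `exp(-(1 - 2πiξ)t)` are the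
values of the Fourier transform of the integrable function `exp(-t) f(t)`. -/
theorem eq_zero_of_inner_expL2 {f : L2pos}
    (h : ∀ (s : ℂ) (hs : 0 < s.re), inner ℂ (expL2 s hs) f = 0) : f = 0 := by
  have h1 : (0 : ℝ) < (1 : ℂ).re := by simp
  set k : ℝ → ℂ := (Ioi (0 : ℝ)).indicator fun t => Complex.exp (-t) * f t with hk
  have hmem : MemLp (fun t : ℝ => Complex.exp (-t)) 2 (volume.restrict (Ioi (0 : ℝ))) := by
    refine (memLp_congr_ae ?_).1 (Lp.memLp (expL2 1 h1))
    filter_upwards [expL2_ae h1] with t ht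
    simpa using ht
  have hki : Integrable k := by
    rw [hk, integrable_indicator_iff measurableSet_Ioi]
    exact hmem.integrable_mul (Lp.memLp f)
  have hk2 : MemLp k 2 volume := by
    rw [hk, memLp_indicator_iff_restrict measurableSet_Ioi]
    refine (Lp.memLp f).of_le ((Complex.continuous_exp.comp
      Complex.continuous_ofReal.neg).aestronglyMeasurable.mul
        (Lp.aestronglyMeasurable f)) ?_
    filter_upwards [ae_restrict_mem measurableSet_Ioi] with t ht
    rw [norm_mul, Complex.norm_exp]
    refine mul_le_of_le_one_left (norm_nonneg _) (Real.exp_le_one_iff.2 ?_)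
    simpa using (mem_Ioi.1 ht).le
  have hF : 𝓕 k = 0 := by
    ext ξ
    have hs : 0 < (1 - 2 * Real.pi * ξ * Complex.I : ℂ).re := by simp
    have h2 := h _ hs
    rw [inner_expL2] at h2
    rw [Real.fourier_real_eq_integral_exp_smul, Pi.zero_apply, ← h2,
      ← integral_indicator measurableSet_Ioi]
    congr 1
    ext t
    by_cases ht : t ∈ Ioi (0 : ℝ)
    · rw [hk, indicator_of_mem ht, indicator_of_mem ht, smul_eq_mul, ← mul_assoc,
        ← Complex.exp_add]
      congr 2
      simp [Complex.conj_ofNat]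
      ring
    · rw [hk, indicator_of_notMem ht, indicator_of_notMem ht, smul_zero]
  have hz : Lp.fourierTransformₗᵢ ℝ ℂ (hk2.toLp k) = 0 := by
    rw [Lp.eq_zero_iff_ae_eq_zero]
    filter_upwards [fourierTransform_toLp_ae_eq hki hk2] with ξ hξ
    rw [hξ, hF]
  have hz2 : hk2.toLp k = 0 := (map_eq_zero_iff _ (LinearIsometryEquiv.injective _)).1 hz
  rw [Lp.eq_zero_iff_ae_eq_zero] at hz2 ⊢
  filter_upwards [ae_restrict_of_ae (hk2.coeFn_toLp), ae_restrict_of_ae hz2,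
    ae_restrict_mem measurableSet_Ioi] with t h3 h4 h5
  rw [h4, hk, indicator_of_mem h5] at h3
  simpa using h3

/-! ### Toeplitz operators commute with left shifts -/

theorem measurePreserving_add_right_Ioi (τ : ℝ) :
    MeasurePreserving (fun t : ℝ => t + τ) (volume.restrict (Ioi (0 : ℝ)))
      (volume.restrict (Ioi τ)) := by
  have h := (measurePreserving_add_right (volume : Measure ℝ) τ).restrict_preimage
    (measurableSet_Ioi (a := τ))
  simpa using h

theorem ae_comp_add_right {τ : ℝ} (hτ : 0 ≤ τ) {p : ℝ → Prop}
    (h : ∀ᵐ t ∂(volume.restrict (Ioi (0 : ℝ))), p t) :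
    ∀ᵐ t ∂(volume.restrict (Ioi (0 : ℝ))), p (t + τ) :=
  (measurePreserving_add_right_Ioi τ).quasiMeasurePreserving.ae
    (ae_restrict_of_ae_restrict_of_subset (Ioi_subset_Ioi hτ) h)

theorem memLp_comp_add_right {τ : ℝ} (hτ : 0 ≤ τ) (f : L2pos) :
    MemLp (fun t => f (t + τ)) 2 (volume.restrict (Ioi (0 : ℝ))) :=
  MemLp.comp_measurePreserving
    ((Lp.memLp f).mono_measure (Measure.restrict_mono (Ioi_subset_Ioi hτ) le_rfl))
    (measurePreserving_add_right_Ioi τ)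

/-- The left shift `f ↦ f(· + τ)` on `L²(0,∞)`. -/
def leftShift (τ : ℝ≥0) : L2pos →L[ℂ] L2pos :=
  LinearMap.mkContinuous
    { toFun := fun f => (memLp_comp_add_right τ.coe_nonneg f).toLp _
      map_add' := fun f f' => by
        rw [← MemLp.toLp_add, MemLp.toLp_eq_toLp_iff]
        exact ae_comp_add_right τ.coe_nonneg (Lp.coeFn_add f f')
      map_smul' := fun c f => by
        rw [RingHom.id_apply, ← MemLp.toLp_const_smul, MemLp.toLp_eq_toLp_iff]
        exact ae_comp_add_right τ.coe_nonneg (Lp.coeFn_smul c f) }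
    1 fun f => by
      change ‖(memLp_comp_add_right τ.coe_nonneg f).toLp _‖ ≤ 1 * ‖f‖
      rw [one_mul, Lp.norm_toLp, Lp.norm_def]
      refine ENNReal.toReal_mono (Lp.eLpNorm_ne_top f) ?_
      have hm : AEStronglyMeasurable f (volume.restrict (Ioi (τ : ℝ))) :=
        (Lp.aestronglyMeasurable f).mono_measure
          (Measure.restrict_mono (Ioi_subset_Ioi τ.coe_nonneg) le_rfl)
      have h := eLpNorm_comp_measurePreserving (p := 2) hm (measurePreserving_add_right_Ioi τ)
      exact (le_of_eq h).trans
        (eLpNorm_mono_measure _ (Measure.restrict_mono (Ioi_subset_Ioi τ.coe_nonneg) le_rfl))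

theorem leftShift_ae (τ : ℝ≥0) (f : L2pos) :
    ∀ᵐ t ∂(volume.restrict (Ioi (0 : ℝ))), leftShift τ f t = f (t + τ) :=
  (memLp_comp_add_right τ.coe_nonneg f).coeFn_toLp

theorem inner_expL2_leftShift {s : ℂ} (hs : 0 < s.re) (τ : ℝ≥0) (f : L2pos) :
    inner ℂ (expL2 s hs) (leftShift τ f) = inner ℂ (shiftedExpL2 s hs τ) f := by
  rw [inner_expL2, inner_shiftedExpL2 hs τ.coe_nonneg]
  refine integral_congr_ae ?_
  filter_upwards [leftShift_ae τ f] with t ht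
  rw [ht]

theorem leftShift_expL2 {s : ℂ} (hs : 0 < s.re) (τ : ℝ≥0) :
    leftShift τ (expL2 s hs) = Complex.exp (-s * τ) • expL2 s hs := by
  refine Lp.ext ?_
  filter_upwards [leftShift_ae τ (expL2 s hs), ae_comp_add_right τ.coe_nonneg (expL2_ae hs),
    expL2_ae hs, Lp.coeFn_smul (Complex.exp (-s * τ)) (expL2 s hs)] with t h1 h2 h3 h4
  rw [h1, h2, h4, Pi.smul_apply, h3, smul_eq_mul, ← Complex.exp_add]
  congr 1; push_cast; ring

namespace HInfLeft

variable (g : HInfLeft)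

theorem norm_le_supNorm {z : ℂ} (hz : z.re < 0) : ‖g.toFun z‖ ≤ g.supNorm := by
  obtain ⟨C, hC⟩ := g.bdd
  exact le_ciSup (f := fun z : {z : ℂ // z.re < 0} => ‖g.toFun z‖)
    ⟨C, by rintro _ ⟨w, rfl⟩; exact hC w w.2⟩ ⟨z, hz⟩

theorem supNorm_nonneg : 0 ≤ g.supNorm :=
  (norm_nonneg _).trans (g.norm_le_supNorm (z := -1) (by simp))

/-- The boundary function of `g` is almost everywhere a genuine limit, so the default value in its
definition plays no role. -/
theorem ae_tendsto_boundary : ∀ᵐ ξ : ℝ,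
    Tendsto (fun a : ℝ => g.toFun (a + 2 * Real.pi * ξ * Complex.I)) (𝓝[<] 0)
      (𝓝 (g.boundary ξ)) := by
  filter_upwards [ae_exists_tendsto_horizontal g.holo fun z hz => g.norm_le_supNorm hz] with ξ hξ
  rw [boundary, if_pos hξ]
  exact tendsto_nhds_limUnder hξ

theorem ae_norm_boundary_le : ∀ᵐ ξ : ℝ, ‖g.boundary ξ‖ ≤ g.supNorm := by
  filter_upwards [g.ae_tendsto_boundary] with ξ hξ
  refine le_of_tendsto hξ.norm ?_
  filter_upwards [self_mem_nhdsWithin] with a ha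
  exact g.norm_le_supNorm (by simpa using ha)

theorem norm_boundaryLp_le : ‖g.boundaryLp‖ ≤ g.supNorm := by
  rw [boundaryLp, Lp.norm_toLp, eLpNorm_exponent_top]
  exact ENNReal.toReal_le_of_le_ofReal g.supNorm_nonneg
    (eLpNormEssSup_le_of_ae_bound g.ae_norm_boundary_le)

theorem boundary_smul_ae (f : L2line) :
    ∀ᵐ ξ : ℝ, (g.boundaryLp • f : L2line) ξ = g.boundary ξ * f ξ := by
  filter_upwards [Lp.coeFn_lpSMul (r := 2) g.boundaryLp f, g.memLp_boundary.coeFn_toLp] with ξ h1 h2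
  rw [h1, Pi.smul_apply', boundaryLp, h2, smul_eq_mul]

theorem norm_toeplitz_le (f : L2pos) : ‖g.toeplitz f‖ ≤ g.supNorm * ‖f‖ := by
  rw [toeplitz, LinearIsometryEquiv.norm_map]
  refine (Submodule.norm_orthogonalProjectionOnto_apply_le _ _).trans ?_
  refine (Lp.norm_smul_le _ _).trans ?_
  rw [LinearIsometry.norm_map]
  gcongr
  exact g.norm_boundaryLp_le

/-- The Toeplitz operator `M_g` as a bounded operator on `L²(0,∞)`. -/
def toeplitzL : L2pos →L[ℂ] L2pos :=
  LinearMap.mkContinuous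
    { toFun := g.toeplitz
      map_add' := fun f f' => by
        simp only [toeplitz, map_add, Lp.add_smul]
      map_smul' := fun c f => by
        have h : (g.boundaryLp • (c • laplace f) : L2line) =
            c • (g.boundaryLp • laplace f : L2line) :=
          (Lp.smul_comm c g.boundaryLp (laplace f)).symm
        simp only [toeplitz, map_smul, RingHom.id_apply, h] }
    g.supNorm g.norm_toeplitz_le

theorem toeplitzL_apply (f : L2pos) : g.toeplitzL f = g.toeplitz f := rfl

theorem inner_toeplitz (φ f : L2pos) :
    inner ℂ φ (g.toeplitz f) = inner ℂ (laplace φ) (g.boundaryLp • laplace f : L2line) := by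
  have h1 : inner ℂ φ (g.toeplitz f) = inner ℂ (laplaceEquiv φ)
      (hardy.orthogonalProjectionOnto (g.boundaryLp • laplace f : L2line)) := by
    rw [toeplitz, ← LinearIsometryEquiv.inner_map_map laplaceEquiv,
      LinearIsometryEquiv.apply_symm_apply]
  rw [h1, Submodule.inner_orthogonalProjectionOnto_eq_of_mem_left]
  rfl

theorem inner_shiftedExpL2_toeplitz {s μ : ℂ} (hs : 0 < s.re) (hμ : 0 < μ.re) (τ : ℝ≥0) :
    inner ℂ (shiftedExpL2 μ hμ τ) (g.toeplitz (expL2 s hs)) =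
      ∫ ξ : ℝ, g.boundary ξ * Complex.exp (2 * Real.pi * ξ * Complex.I * τ) /
        ((s + 2 * Real.pi * ξ * Complex.I) *
          (starRingEnd ℂ μ - 2 * Real.pi * ξ * Complex.I)) := by
  rw [inner_toeplitz, L2.inner_def]
  refine integral_congr_ae ?_
  filter_upwards [laplace_shiftedExpL2 hμ τ.coe_nonneg, laplace_shiftedExpL2 hs le_rfl,
    g.boundary_smul_ae (laplace (expL2 s hs))] with ξ h1 h2 h3
  rw [h3, RCLike.inner_apply, expL2, h1, h2, map_div₀, ← Complex.exp_conj]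
  simp only [map_neg, map_mul, map_add, Complex.conj_I, Complex.conj_ofReal, Complex.conj_ofNat,
    Complex.ofReal_zero, mul_zero, Complex.exp_zero, mul_neg, neg_mul, neg_neg, ← sub_eq_add_neg]
  rw [mul_one_div, div_mul_div_comm]

end HInfLeft

theorem memLp_inv_add_imaginary {s : ℂ} (hs : 0 < s.re) :
    MemLp (fun ξ : ℝ => (s + 2 * Real.pi * ξ * Complex.I)⁻¹) 2 volume := by
  refine (memLp_congr_ae ?_).1 (Lp.memLp (laplace (expL2 s hs)))
  filter_upwards [laplace_shiftedExpL2 hs le_rfl] with ξ hξ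
  rw [expL2, hξ]
  simp

theorem memLp_inv_sub_imaginary {s : ℂ} (hs : 0 < s.re) :
    MemLp (fun ξ : ℝ => (s - 2 * Real.pi * ξ * Complex.I)⁻¹) 2 volume := by
  have h := (memLp_inv_add_imaginary (conj_re_pos hs)).star
  refine (memLp_congr_ae (Eventually.of_forall fun ξ => ?_)).1 h
  simp only [Pi.star_apply, RCLike.star_def, map_inv₀, map_add, map_mul, Complex.conj_conj,
    Complex.conj_ofReal, Complex.conj_I, Complex.conj_ofNat, mul_neg, ← sub_eq_add_neg]

theorem norm_exp_mul_le_one {z : ℂ} (hz : z.re ≤ 0) (τ : ℝ≥0) : ‖Complex.exp (z * τ)‖ ≤ 1 := by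
  rw [Complex.norm_exp, Real.exp_le_one_iff]
  simpa using mul_nonpos_of_nonpos_of_nonneg hz τ.coe_nonneg

namespace HInfLeft

variable (g : HInfLeft)

/-- Cauchy's theorem for the boundary values of a bounded holomorphic function. The quotient
`(exp(zτ) - exp(-sτ)) / (s + z)` is holomorphic and bounded in the left half-plane, because `-s` is
a zero of the numerator. -/
theorem integral_boundary_mul_eq_zero {s μ : ℂ} (hs : 0 < s.re) (hμ : 0 < μ.re) (τ : ℝ≥0) :
    ∫ ξ : ℝ, g.boundary ξ *
      ((Complex.exp (2 * Real.pi * ξ * Complex.I * τ) - Complex.exp (-s * τ)) /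
        ((s + 2 * Real.pi * ξ * Complex.I) * (μ - 2 * Real.pi * ξ * Complex.I))) = 0 := by
  set Q : ℂ → ℂ := dslope (fun z => Complex.exp (z * τ)) (-s) with hQ
  have hE : Differentiable ℂ fun z : ℂ => Complex.exp (z * τ) := by fun_prop
  have hQd : Differentiable ℂ Q := by
    rw [← differentiableOn_univ]
    exact (Complex.differentiableOn_dslope univ_mem).2 hE.differentiableOn
  have hQv : ∀ z : ℂ, z ≠ -s → Q z = (Complex.exp (z * τ) - Complex.exp (-s * τ)) / (s + z) :=
    fun z hz => by rw [hQ, dslope_of_ne _ hz, slope_def_field, sub_neg_eq_add, add_comm z]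
  have hQn : ∀ z : ℂ, z ≠ -s → z.re ≤ 0 → ‖Q z‖ ≤ 2 * ‖(s + z)⁻¹‖ := fun z hz hz0 => by
    rw [hQv z hz, div_eq_mul_inv, norm_mul]
    gcongr
    refine (norm_sub_le _ _).trans ?_
    have h1 := norm_exp_mul_le_one hz0 τ
    have h2 := norm_exp_mul_le_one (z := -s) (by simpa using hs.le) τ
    linarith
  have him : ∀ ξ : ℝ, (2 * Real.pi * ξ * Complex.I : ℂ).re = 0 := fun ξ => by simp
  have hne : ∀ ξ : ℝ, (2 * Real.pi * ξ * Complex.I : ℂ) ≠ -s := fun ξ h => by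
    have := congrArg Complex.re h
    rw [him, Complex.neg_re] at this
    linarith
  have hμz : ∀ z : ℂ, z.re ≤ 0 → μ - z ≠ 0 := fun z hz h => by
    rw [← sub_eq_zero.1 h] at hz; linarith
  have hC0 := g.supNorm_nonneg
  -- a dominating function for the passage to the limit `a → 0`
  have hdom : Integrable fun ξ : ℝ => g.supNorm * (2 * ‖(s + 2 * Real.pi * ξ * Complex.I)⁻¹‖) *
      ‖(μ - 2 * Real.pi * ξ * Complex.I)⁻¹‖ := by
    have h := ((memLp_inv_add_imaginary hs).integrable_mul (memLp_inv_sub_imaginary hμ)).norm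
    refine (h.const_mul (g.supNorm * 2)).congr (Eventually.of_forall fun ξ => ?_)
    simp only [Pi.mul_apply, norm_mul]
    ring
  -- Cauchy's theorem for `z ↦ g (a + z)`, which is holomorphic across the imaginary axis
  have hshift : ∀ a : ℝ, a < 0 → ∫ ξ : ℝ, g.toFun (a + 2 * Real.pi * ξ * Complex.I) *
      Q (2 * Real.pi * ξ * Complex.I) / (μ - 2 * Real.pi * ξ * Complex.I) = 0 := fun a ha => by
    have hga : DifferentiableOn ℂ (fun z => g.toFun (a + z)) {z | z.re ≤ 0} :=
      g.holo.comp (by fun_prop) fun z hz => by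
        have : z.re ≤ 0 := hz
        simp only [mem_ofPred_eq, Complex.add_re, Complex.ofReal_re]
        linarith
    have hHd : DifferentiableOn ℂ (fun z => g.toFun (a + z) * Q z / (μ - z)) {z | z.re ≤ 0} :=
      (hga.mul hQd.differentiableOn).div (by fun_prop) fun z hz => hμz z hz
    have hHn : ∀ z : ℂ, z ≠ -s → z.re ≤ 0 → ‖g.toFun (a + z) * Q z / (μ - z)‖ ≤
        g.supNorm * (2 * ‖(s + z)⁻¹‖) * ‖(μ - z)⁻¹‖ := fun z hz hz0 => by
      rw [div_eq_mul_inv, norm_mul, norm_mul]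
      gcongr
      · exact g.norm_le_supNorm (by simp only [Complex.add_re, Complex.ofReal_re]; linarith)
      · exact hQn z hz hz0
    have hcont : Continuous fun y : ℝ => g.toFun (a + y * Complex.I) * Q (y * Complex.I) /
        (μ - y * Complex.I) :=
      hHd.continuousOn.comp_continuous (f := fun y : ℝ => (y : ℂ) * Complex.I) (by fun_prop)
        fun y => by simp
    have hint : Integrable fun ξ : ℝ => g.toFun (a + (2 * Real.pi * ξ : ℝ) * Complex.I) *
        Q ((2 * Real.pi * ξ : ℝ) * Complex.I) / (μ - (2 * Real.pi * ξ : ℝ) * Complex.I) := by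
      refine hdom.mono' (hcont.comp (by fun_prop : Continuous fun ξ : ℝ =>
        2 * Real.pi * ξ)).aestronglyMeasurable (Eventually.of_forall fun ξ => ?_)
      have h := hHn _ (hne ξ) (him ξ).le
      push_cast
      exact h
    have hpi : 2 * Real.pi ≠ 0 := by positivity
    have hV := integral_imaginaryAxis_eq_zero (H := fun z => g.toFun (a + z) * Q z / (μ - z))
      (K := 8 * g.supNorm) (R₀ := 2 * (‖s‖ + ‖μ‖)) hHd.continuousOn
      (hHd.mono fun z (hz : z.re < 0) => hz.le) ?_ ((integrable_comp_mul_left_iff _ hpi).1 hint)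
    · have h := Measure.integral_comp_mul_left (fun y : ℝ => g.toFun (a + y * Complex.I) *
        Q (y * Complex.I) / (μ - y * Complex.I)) (2 * Real.pi)
      rw [hV, smul_zero] at h
      push_cast at h
      exact h
    · intro z hz hR
      have hs0 : 0 < ‖s‖ := norm_pos_iff.2 fun h => by simp [h] at hs
      have hμ0 := norm_nonneg μ
      have hz1 : z ≠ -s := by
        rintro rfl
        rw [norm_neg] at hR
        linarith
      have hz0 : 0 < ‖z‖ := by linarith
      have h1 : ‖z‖ / 2 ≤ ‖s + z‖ := by
        have := norm_sub_le (s + z) s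
        rw [add_sub_cancel_left] at this
        linarith
      have h2 : ‖z‖ / 2 ≤ ‖μ - z‖ := by
        have := norm_sub_le μ (μ - z)
        rw [sub_sub_cancel] at this
        linarith
      refine (hHn z hz1 hz).trans ?_
      rw [norm_inv, norm_inv]
      calc g.supNorm * (2 * ‖s + z‖⁻¹) * ‖μ - z‖⁻¹
          ≤ g.supNorm * (2 * (‖z‖ / 2)⁻¹) * (‖z‖ / 2)⁻¹ := by gcongr
        _ = 8 * g.supNorm / ‖z‖ ^ 2 := by field_simp; norm_num
  have hlim : Tendsto (fun a : ℝ => ∫ ξ : ℝ, g.toFun (a + 2 * Real.pi * ξ * Complex.I) *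
      Q (2 * Real.pi * ξ * Complex.I) / (μ - 2 * Real.pi * ξ * Complex.I)) (𝓝[<] 0)
      (𝓝 (∫ ξ : ℝ, g.boundary ξ * Q (2 * Real.pi * ξ * Complex.I) /
        (μ - 2 * Real.pi * ξ * Complex.I))) := by
    refine tendsto_integral_filter_of_dominated_convergence _ ?_ ?_ hdom ?_
    · filter_upwards [self_mem_nhdsWithin] with a (ha : a < 0)
      refine Continuous.aestronglyMeasurable (Continuous.div (Continuous.mul ?_ ?_) (by fun_prop)
        fun ξ => hμz _ (him ξ).le)
      · exact g.holo.continuousOn.comp_continuous (by fun_prop) fun ξ => by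
          rw [mem_ofPred_eq, Complex.add_re, him, Complex.ofReal_re, add_zero]; exact ha
      · exact hQd.continuous.comp (by fun_prop)
    · filter_upwards [self_mem_nhdsWithin] with a (ha : a < 0)
      refine Eventually.of_forall fun ξ => ?_
      rw [div_eq_mul_inv, norm_mul, norm_mul]
      gcongr
      · exact g.norm_le_supNorm (by rw [Complex.add_re, him, Complex.ofReal_re, add_zero]; exact ha)
      · exact hQn _ (hne ξ) (him ξ).le
    · filter_upwards [g.ae_tendsto_boundary] with ξ hξ
      exact (hξ.mul_const _).div_const _
  have hzero : ∫ ξ : ℝ, g.boundary ξ * Q (2 * Real.pi * ξ * Complex.I) /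
      (μ - 2 * Real.pi * ξ * Complex.I) = 0 := by
    refine tendsto_nhds_unique hlim (tendsto_const_nhds.congr' ?_)
    filter_upwards [self_mem_nhdsWithin] with a ha using (hshift a ha).symm
  rw [← hzero]
  congr 1
  ext ξ
  rw [hQv _ (hne ξ), mul_div_assoc, div_div]

theorem toeplitz_leftShift (τ : ℝ≥0) (f : L2pos) :
    g.toeplitz (leftShift τ f) = leftShift τ (g.toeplitz f) := by
  rw [← sub_eq_zero]
  refine eq_zero_of_inner_expL2 fun μ hμ => ?_
  -- Both sides are linear and continuous in `f`, so that exponentials suffice for `f`, too.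
  set D : L2pos →L[ℂ] L2pos := g.toeplitzL ∘L leftShift τ - leftShift τ ∘L g.toeplitzL with hD
  suffices h : ContinuousLinearMap.adjoint D (expL2 μ hμ) = 0 by
    have h2 := ContinuousLinearMap.adjoint_inner_left D f (expL2 μ hμ)
    rw [h, inner_zero_left] at h2
    exact h2.symm
  refine eq_zero_of_inner_expL2 fun s hs => ?_
  rw [ContinuousLinearMap.adjoint_inner_right, ← inner_conj_symm]
  refine (map_eq_zero _).2 ?_
  have e1 : D (expL2 s hs) = Complex.exp (-s * τ) • g.toeplitz (expL2 s hs) -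
      leftShift τ (g.toeplitz (expL2 s hs)) := by
    simp only [hD, sub_apply, ContinuousLinearMap.comp_apply, leftShift_expL2,
      map_smul, toeplitzL_apply]
  have hint : ∀ r : ℝ≥0, Integrable fun ξ : ℝ => g.boundary ξ *
      Complex.exp (2 * Real.pi * ξ * Complex.I * r) / ((s + 2 * Real.pi * ξ * Complex.I) *
          (starRingEnd ℂ μ - 2 * Real.pi * ξ * Complex.I)) := fun r => by
    have h := ((memLp_inv_add_imaginary hs).integrable_mul
      (memLp_inv_sub_imaginary (conj_re_pos hμ)))
    refine (h.norm.const_mul g.supNorm).mono' ?_ ?_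
    · have h3 : AEStronglyMeasurable (fun ξ : ℝ => g.boundary ξ *
        Complex.exp (2 * Real.pi * ξ * Complex.I * r)) volume :=
        g.memLp_boundary.aestronglyMeasurable.mul
          (Continuous.aestronglyMeasurable (by fun_prop))
      refine (h3.mul h.aestronglyMeasurable).congr (Eventually.of_forall fun ξ => ?_)
      simp only [Pi.mul_apply, div_eq_mul_inv, mul_inv]
    · filter_upwards [g.ae_norm_boundary_le] with ξ hξ
      rw [div_eq_mul_inv, norm_mul, norm_mul, mul_inv]
      simp only [Pi.mul_apply]
      gcongr
      exact (mul_le_of_le_one_right (norm_nonneg _) (norm_exp_mul_le_one (by simp) r)).trans hξ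
  have e2 := g.inner_shiftedExpL2_toeplitz hs hμ τ
  have e3 := g.inner_shiftedExpL2_toeplitz hs hμ 0
  have h0 := g.integral_boundary_mul_eq_zero hs (conj_re_pos hμ) τ
  have h4 : ∫ ξ : ℝ, g.boundary ξ *
      ((Complex.exp (2 * Real.pi * ξ * Complex.I * τ) - Complex.exp (-s * τ)) /
        ((s + 2 * Real.pi * ξ * Complex.I) *
          (starRingEnd ℂ μ - 2 * Real.pi * ξ * Complex.I))) =
      inner ℂ (shiftedExpL2 μ hμ τ) (g.toeplitz (expL2 s hs)) -
        Complex.exp (-s * τ) * inner ℂ (shiftedExpL2 μ hμ (0 : ℝ≥0)) (g.toeplitz (expL2 s hs)) := by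
    rw [e2, e3, ← integral_const_mul, ← integral_sub (hint τ) ((hint 0).const_mul _)]
    congr 1
    ext ξ
    simp only [NNReal.coe_zero, Complex.ofReal_zero, mul_zero, Complex.exp_zero]
    ring
  rw [h0] at h4
  rw [e1, inner_sub_right, inner_smul_right, inner_expL2_leftShift]
  have h5 : expL2 μ hμ = shiftedExpL2 μ hμ (0 : ℝ≥0) := rfl
  rw [h5]
  linear_combination h4

end HInfLeft

/-! ### The resolvent of an exponentially stable semigroup -/

namespace C0Semigroup

variable {X : Type*} [NormedAddCommGroup X] [NormedSpace ℂ X] {T : C0Semigroup X}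

theorem ExpStable.exists_bound (hT : T.ExpStable) :
    ∃ M ω : ℝ, 0 ≤ M ∧ 0 < ω ∧ ∀ (t : ℝ≥0) (x : X), ‖T.op t x‖ ≤ M * Real.exp (-ω * t) * ‖x‖ := by
  obtain ⟨M, ω, hω, h⟩ := hT
  refine ⟨M, ω, (norm_nonneg (T.op 0)).trans (by simpa using h 0), hω, fun t x => ?_⟩
  exact (T.op t).le_of_opNorm_le (h t) x

theorem ExpStable.exists_uniform_bound (hT : T.ExpStable) :
    ∃ M : ℝ, 0 ≤ M ∧ ∀ (t : ℝ≥0) (x : X), ‖T.op t x‖ ≤ M * ‖x‖ := by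
  obtain ⟨M, ω, hM, hω, h⟩ := hT.exists_bound
  refine ⟨M, hM, fun t x => (h t x).trans ?_⟩
  gcongr
  refine mul_le_of_le_one_right hM (Real.exp_le_one_iff.2 ?_)
  rw [neg_mul, neg_nonpos]; positivity

theorem op_comm (T : C0Semigroup X) (s t : ℝ≥0) (x : X) :
    T.op s (T.op t x) = T.op t (T.op s x) := by
  rw [← ContinuousLinearMap.comp_apply, ← ContinuousLinearMap.comp_apply, ← T.op_add,
    ← T.op_add, add_comm]

theorem op_add_apply (T : C0Semigroup X) (s t : ℝ≥0) (x : X) :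
    T.op (s + t) x = T.op s (T.op t x) := by
  rw [T.op_add, ContinuousLinearMap.comp_apply]

/-- For `a ≤ b`, `T(b)x - T(a)x = T(a)(T(b-a)x - x)`, so uniform boundedness of the semigroup
spreads the continuity at `0` to both sides of every point. -/
theorem ExpStable.continuous_orbit (hT : T.ExpStable) (x : X) :
    Continuous fun t : ℝ≥0 => T.op t x := by
  obtain ⟨M, hM, h⟩ := hT.exists_uniform_bound
  have key : ∀ a b : ℝ≥0, a ≤ b → ‖T.op b x - T.op a x‖ ≤ M * ‖T.op (b - a) x - x‖ :=
    fun a b hab => by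
      have : T.op b x - T.op a x = T.op a (T.op (b - a) x - x) := by
        rw [map_sub, ← op_add_apply, add_tsub_cancel_of_le hab]
      rw [this]; exact h _ _
  have key' : ∀ a b : ℝ≥0, ‖T.op b x - T.op a x‖ ≤ M * ‖T.op (nndist b a) x - x‖ := fun a b => by
    rw [NNReal.nndist_eq]
    rcases le_total a b with hab | hab
    · rw [tsub_eq_zero_of_le hab, max_eq_left zero_le]; exact key a b hab
    · rw [tsub_eq_zero_of_le hab, max_eq_right zero_le, norm_sub_rev]; exact key b a hab
  rw [continuous_iff_continuousAt]
  intro a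
  rw [ContinuousAt, tendsto_iff_norm_sub_tendsto_zero]
  have h1 : Tendsto (fun b : ℝ≥0 => nndist b a) (𝓝 a) (𝓝 0) := by
    have : Continuous fun b : ℝ≥0 => nndist b a := by fun_prop
    simpa using this.tendsto a
  have h2 := ((T.strong_cont x).comp h1).sub_const x |>.norm.const_mul M
  simp only [sub_self, norm_zero, mul_zero] at h2
  exact squeeze_zero (fun _ => norm_nonneg _) (key' a) h2

theorem ExpStable.continuous_orbit_real (hT : T.ExpStable) (x : X) :
    Continuous fun t : ℝ => T.op t.toNNReal x :=
  (hT.continuous_orbit x).comp continuous_real_toNNReal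

theorem ExpStable.integrableOn_exp_smul_orbit (hT : T.ExpStable) {s : ℂ} (hs : 0 < s.re) (x : X) :
    IntegrableOn (fun t : ℝ => Complex.exp (-s * t) • T.op t.toNNReal x) (Ioi 0) := by
  obtain ⟨M, hM, h⟩ := hT.exists_uniform_bound
  have h1 := (integrableOn_exp_mul_complex_Ioi (a := -s) (by simpa using hs) 0).norm.mul_const
    (M * ‖x‖)
  refine h1.mono' ?_ (Eventually.of_forall fun t => ?_)
  · have := hT.continuous_orbit_real x
    exact Continuous.aestronglyMeasurable (by fun_prop)
  · rw [norm_smul]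
    gcongr
    exact h _ _

theorem incl_injective (T : C0Semigroup X) : Function.Injective T.incl := Subtype.val_injective

theorem gen_onX1 (T : C0Semigroup X) (t : ℝ≥0) (x : T.X1) :
    T.gen (T.onX1 t x) = T.op t (T.gen x) :=
  (T.gen_spec (T.onX1 t x)).unique ((T.gen_spec x).map t)

theorem onX1_zero (T : C0Semigroup X) (x : T.X1) : T.onX1 0 x = x :=
  T.incl_injective (by rw [incl_onX1, T.op_zero]; rfl)

theorem ExpStable.continuous_onX1 (hT : T.ExpStable) (x : T.X1) :
    Continuous fun t : ℝ≥0 => T.onX1 t x := by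
  rw [continuous_iff_continuousAt]
  intro a
  rw [ContinuousAt, tendsto_iff_norm_sub_tendsto_zero]
  have h1 := tendsto_iff_norm_sub_tendsto_zero.1 ((hT.continuous_orbit (T.incl x)).tendsto a)
  have h2 := tendsto_iff_norm_sub_tendsto_zero.1 ((hT.continuous_orbit (T.gen x)).tendsto a)
  refine ((h1.add h2).congr fun t => ?_).trans_eq (by rw [add_zero])
  rw [GraphDomain.norm_def, map_sub, map_sub]
  change _ = ‖T.incl _ - T.incl _‖ + ‖T.gen _ - T.gen _‖
  rw [incl_onX1, incl_onX1, gen_onX1, gen_onX1]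

/-- The bounded operator `s - A : X₁ → X`. -/
def subGenL (T : C0Semigroup X) (s : ℂ) : T.X1 →L[ℂ] X :=
  (s • T.incl - T.gen).mkContinuous (‖s‖ + 1) fun x => by
    rw [LinearMap.sub_apply, LinearMap.smul_apply, GraphDomain.norm_def]
    refine (norm_sub_le _ _).trans ?_
    rw [norm_smul]
    change ‖s‖ * ‖T.incl x‖ + ‖T.gen x‖ ≤ (‖s‖ + 1) * (‖T.incl x‖ + ‖T.gen x‖)
    nlinarith [norm_nonneg s, norm_nonneg (T.incl x), norm_nonneg (T.gen x),
      mul_nonneg (norm_nonneg s) (norm_nonneg (T.gen x))]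

theorem subGenL_apply (T : C0Semigroup X) (s : ℂ) (x : T.X1) :
    T.subGenL s x = s • T.incl x - T.gen x := rfl

theorem subGenL_onX1 (T : C0Semigroup X) (s : ℂ) (t : ℝ≥0) (x : T.X1) :
    T.subGenL s (T.onX1 t x) = T.op t (T.subGenL s x) := by
  rw [subGenL_apply, subGenL_apply, incl_onX1, gen_onX1, map_sub, map_smul]

/-- The Laplace transform `x ↦ ∫₀^∞ exp(-st) T(t)x dt` of the semigroup, as an operator on `X`. -/
def resolventL (hT : T.ExpStable) {s : ℂ} (hs : 0 < s.re) : X →L[ℂ] X :=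
  LinearMap.mkContinuousOfExistsBound
    { toFun := fun x => ∫ t in Ioi (0 : ℝ), Complex.exp (-s * t) • T.op t.toNNReal x
      map_add' := fun x x' => by
        rw [← integral_add (hT.integrableOn_exp_smul_orbit hs x)
          (hT.integrableOn_exp_smul_orbit hs x')]
        simp only [map_add, smul_add]
      map_smul' := fun c x => by
        rw [RingHom.id_apply, ← integral_smul]
        simp only [map_smul, smul_comm c] }
    (by
      obtain ⟨M, hM, h⟩ := hT.exists_uniform_bound
      have h1 := (integrableOn_exp_mul_complex_Ioi (a := -s) (by simpa using hs) 0).norm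
      refine ⟨(∫ t in Ioi (0 : ℝ), ‖Complex.exp (-s * t)‖) * M, fun x => ?_⟩
      rw [mul_assoc, ← integral_mul_const]
      refine norm_integral_le_of_norm_le (h1.mul_const _) (Eventually.of_forall fun t => ?_)
      rw [norm_smul]
      gcongr
      exact h _ _)

theorem resolventL_apply (hT : T.ExpStable) {s : ℂ} (hs : 0 < s.re) (x : X) :
    resolventL hT hs x = ∫ t in Ioi (0 : ℝ), Complex.exp (-s * t) • T.op t.toNNReal x := rfl

variable [CompleteSpace X]

theorem resolventL_comm (hT : T.ExpStable) {s : ℂ} (hs : 0 < s.re) (h : ℝ≥0) (x : X) :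
    resolventL hT hs (T.op h x) = T.op h (resolventL hT hs x) := by
  rw [resolventL_apply, resolventL_apply, ← ContinuousLinearMap.integral_comp_comm _
    (hT.integrableOn_exp_smul_orbit hs x)]
  simp only [map_smul, op_comm T h]

/-- Substitution of `t + h` for `t` in the Laplace integral. The right-hand side is a product of
explicitly differentiable functions of `h`, which gives the generator on the range of the
resolvent. -/
theorem op_resolventL (hT : T.ExpStable) {s : ℂ} (hs : 0 < s.re) (h : ℝ≥0) (x : X) :
    T.op h (resolventL hT hs x) = Complex.exp (s * h) • (resolventL hT hs x -
      ∫ t in (0 : ℝ)..h, Complex.exp (-s * t) • T.op t.toNNReal x) := by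
  have hi := hT.integrableOn_exp_smul_orbit hs x
  have e1 : resolventL hT hs x - ∫ t in (0 : ℝ)..h, Complex.exp (-s * t) • T.op t.toNNReal x =
      ∫ t in Ioi (h : ℝ), Complex.exp (-s * t) • T.op t.toNNReal x := by
    rw [resolventL_apply, sub_eq_iff_eq_add']
    exact (intervalIntegral.integral_interval_add_Ioi hi
      (hi.mono_set (Ioi_subset_Ioi h.coe_nonneg))).symm
  have h2 := (measurePreserving_add_right (volume : Measure ℝ) h).setIntegral_preimage_emb
    (measurableEmbedding_addRight (h : ℝ))
    (fun t : ℝ => Complex.exp (-s * t) • T.op t.toNNReal x) (Ioi (h : ℝ))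
  rw [e1, ← h2, ← resolventL_comm, resolventL_apply, ← integral_smul]
  simp only [preimage_add_const_Ioi, sub_self]
  refine setIntegral_congr_fun measurableSet_Ioi fun t ht => ?_
  rw [Real.toNNReal_add (le_of_lt ht) h.coe_nonneg, Real.toNNReal_coe, op_add_apply, smul_smul,
    ← Complex.exp_add]
  congr 2
  push_cast; ring

theorem hasGen_resolventL (hT : T.ExpStable) {s : ℂ} (hs : 0 < s.re) (x : X) :
    T.HasGen (resolventL hT hs x) (s • resolventL hT hs x - x) := by
  set r := resolventL hT hs x with hr
  have hcont : Continuous fun t : ℝ => Complex.exp (-s * t) • T.op t.toNNReal x := by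
    have := hT.continuous_orbit_real x
    fun_prop
  have h1 : HasDerivAt
      (fun h : ℝ => r - ∫ t in (0 : ℝ)..h, Complex.exp (-s * t) • T.op t.toNNReal x)
      (-x) 0 := by
    have := (hcont.integral_hasStrictDerivAt 0 0).hasDerivAt.const_sub r
    simpa [T.op_zero] using this
  have h2 : HasDerivAt (fun h : ℝ => Complex.exp (s * h)) s 0 := by
    have := ((hasDerivAt_id (0 : ℝ)).ofReal_comp.const_mul s).cexp
    simpa using this
  have h3 := (h2.smul h1).tendsto_slope
  simp only [Complex.ofReal_zero, mul_zero, Complex.exp_zero, one_smul,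
    intervalIntegral.integral_same, sub_zero] at h3
  have h4 : Tendsto (fun t : ℝ≥0 => (t : ℝ)) (𝓝[≠] 0) (𝓝[≠] 0) := by
    refine tendsto_nhdsWithin_iff.2 ⟨?_, ?_⟩
    · exact (NNReal.continuous_coe.tendsto 0).mono_left nhdsWithin_le_nhds
    · filter_upwards [self_mem_nhdsWithin] with t ht
      exact NNReal.coe_ne_zero.2 ht
  refine ((h3.comp h4).congr fun t => ?_).trans_eq (by congr 1; abel)
  rw [Function.comp_apply, slope_def_module, hr, op_resolventL hT hs t x, ← hr]
  simp only [Pi.smul_apply', Complex.ofReal_zero, mul_zero, Complex.exp_zero, one_smul,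
    intervalIntegral.integral_same, sub_zero]
  rw [← Complex.coe_smul, Complex.ofReal_inv]

/-- The Laplace transform of the semigroup, with values in `X₁`. -/
def resolventX1 (hT : T.ExpStable) {s : ℂ} (hs : 0 < s.re) (x : X) : T.X1 :=
  ⟨resolventL hT hs x, s • resolventL hT hs x - x, hasGen_resolventL hT hs x⟩

theorem incl_resolventX1 (hT : T.ExpStable) {s : ℂ} (hs : 0 < s.re) (x : X) :
    T.incl (resolventX1 hT hs x) = resolventL hT hs x := rfl

theorem gen_resolventX1 (hT : T.ExpStable) {s : ℂ} (hs : 0 < s.re) (x : X) :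
    T.gen (resolventX1 hT hs x) = s • resolventL hT hs x - x :=
  (T.gen_spec (resolventX1 hT hs x)).unique (hasGen_resolventL hT hs x)

theorem resolventL_gen (hT : T.ExpStable) {s : ℂ} (hs : 0 < s.re) (u : T.X1) :
    resolventL hT hs (s • T.incl u - T.gen u) = T.incl u := by
  have h1 : T.HasGen (resolventL hT hs (T.incl u)) (resolventL hT hs (T.gen u)) := by
    refine ((((resolventL hT hs).continuous.tendsto _).comp (T.gen_spec u))).congr fun t => ?_
    simp only [Function.comp_apply, map_smul, map_sub, resolventL_comm]
  have h2 := h1.unique (hasGen_resolventL hT hs (T.incl u))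
  rw [map_sub, map_smul, h2, sub_sub_cancel]

theorem exists_isResolvent (hT : T.ExpStable) {s : ℂ} (hs : 0 < s.re) :
    ∃ R : X →L[ℂ] T.X1, T.IsResolvent s R := by
  let R : X →ₗ[ℂ] T.X1 :=
    { toFun := resolventX1 hT hs
      map_add' := fun x x' => T.incl_injective (by
        rw [map_add, incl_resolventX1, incl_resolventX1, incl_resolventX1, map_add])
      map_smul' := fun c x => T.incl_injective (by
        rw [map_smul, incl_resolventX1, incl_resolventX1, map_smul, RingHom.id_apply]) }
  refine ⟨R.mkContinuous (‖resolventL hT hs‖ + (‖s‖ * ‖resolventL hT hs‖ + 1)) fun x => ?_,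
    fun x => ?_, fun u => T.incl_injective ?_⟩
  · have hb := (resolventL hT hs).le_opNorm x
    change ‖resolventX1 hT hs x‖ ≤ _
    rw [GraphDomain.norm_def]
    change ‖T.incl (resolventX1 hT hs x)‖ + ‖T.gen (resolventX1 hT hs x)‖ ≤ _
    rw [incl_resolventX1, gen_resolventX1]
    have h2 := norm_sub_le (s • resolventL hT hs x) x
    rw [norm_smul] at h2
    have h3 := mul_le_mul_of_nonneg_left hb (norm_nonneg s)
    linarith
  · change s • T.incl (resolventX1 hT hs x) - T.gen (resolventX1 hT hs x) = x
    rw [incl_resolventX1, gen_resolventX1, sub_sub_cancel]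
  · change T.incl (resolventX1 hT hs _) = _
    rw [incl_resolventX1, resolventL_gen]

end C0Semigroup

/-! ### Representation of weakly admissible output mappings -/

/-- The value at `s` of the Laplace transform, as a bounded functional on `L²(0,∞)`. -/
def laplaceAt (s : ℂ) (hs : 0 < s.re) : L2pos →L[ℂ] ℂ :=
  innerSL ℂ (expL2 (starRingEnd ℂ s) (conj_re_pos hs))

theorem laplaceAt_apply {s : ℂ} (hs : 0 < s.re) (f : L2pos) :
    laplaceAt s hs f = ∫ t in Ioi (0 : ℝ), Complex.exp (-s * t) * f t := by
  rw [laplaceAt, innerSL_apply_apply, inner_expL2, Complex.conj_conj]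

theorem norm_laplaceAt_le {s : ℂ} (hs : 0 < s.re) (f : L2pos) :
    ‖laplaceAt s hs f‖ ≤ 1 / √s.re * ‖f‖ := by
  rw [laplaceAt, innerSL_apply_apply]
  refine (norm_inner_le_norm _ _).trans ?_
  gcongr
  simpa using norm_expL2_le (conj_re_pos hs)

theorem laplaceAt_leftShift {s : ℂ} (hs : 0 < s.re) (τ : ℝ≥0) (f : L2pos) :
    laplaceAt s hs (leftShift τ f) = ∫ r in Ioi (0 : ℝ), Complex.exp (-s * r) * f (r + τ) := by
  rw [laplaceAt_apply]
  refine integral_congr_ae ?_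
  filter_upwards [leftShift_ae τ f] with r hr
  rw [hr]

/-- The integrability behind the use of Fubini's theorem in the representation theorem. On a set `A`
of finite measure, `∫_A |f(r + t)| dt` is at most `|A| + ‖f‖²`, uniformly in `r`. -/
theorem integrable_prod_exp_mul_shift {s : ℂ} (hs : 0 < s.re) (f : L2pos) {A : Set ℝ}
    (hA : volume.restrict (Ioi (0 : ℝ)) A < ∞) :
    Integrable (fun p : ℝ × ℝ => Complex.exp (-s * p.1) * f (p.1 + p.2))
      ((volume.restrict (Ioi (0 : ℝ))).prod ((volume.restrict (Ioi (0 : ℝ))).restrict A)) := by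
  set ν := (volume.restrict (Ioi (0 : ℝ))).restrict A with hν
  have : IsFiniteMeasure ν := ⟨by rwa [hν, Measure.restrict_apply_univ]⟩
  have hνle : ν ≤ volume.restrict (Ioi (0 : ℝ)) := Measure.restrict_le_self
  have hmeas : AEStronglyMeasurable (fun p : ℝ × ℝ => Complex.exp (-s * p.1) * f (p.1 + p.2))
      ((volume.restrict (Ioi (0 : ℝ))).prod ν) := by
    refine (Continuous.aestronglyMeasurable (by fun_prop)).mul ?_
    exact ((Lp.stronglyMeasurable f).comp_measurable (by fun_prop)).aestronglyMeasurable
  have hsq : ∀ r : ℝ, r ∈ Ioi (0 : ℝ) → MemLp (fun t => f (r + t)) 2 ν := fun r hr => by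
    have h := memLp_comp_add_right (le_of_lt hr) f
    simp only [add_comm _ r] at h
    exact h.mono_measure hνle
  have hbound : ∀ r : ℝ, r ∈ Ioi (0 : ℝ) →
      ∫ t, ‖f (r + t)‖ ∂ν ≤ ν.real univ + ‖f‖ ^ 2 := fun r hr => by
    have h2 : Integrable (fun t => ‖f (r + t)‖ ^ 2) ν := (hsq r hr).integrable_norm_pow two_ne_zero
    have h3 : ∫ t, ‖f (r + t)‖ ^ 2 ∂ν ≤ ‖f‖ ^ 2 := by
      have h4 := leftShift_ae r.toNNReal f
      rw [Real.coe_toNNReal _ (le_of_lt hr)] at h4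
      have h5 : ‖leftShift r.toNNReal f‖ ≤ ‖f‖ := by
        simpa using (leftShift r.toNNReal).le_of_opNorm_le
          (LinearMap.mkContinuous_norm_le _ zero_le_one _) f
      have h6 : ∫ t in Ioi (0 : ℝ), ‖leftShift r.toNNReal f t‖ ^ 2 =
          ‖leftShift r.toNNReal f‖ ^ 2 := by
        have h7 := L2.inner_def (𝕜 := ℂ) (leftShift r.toNNReal f) (leftShift r.toNNReal f)
        rw [inner_self_eq_norm_sq_to_K] at h7
        simp only [inner_self_eq_norm_sq_to_K] at h7
        have h8 : ((‖leftShift r.toNNReal f‖ ^ 2 : ℝ) : ℂ) =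
            ((∫ t in Ioi (0 : ℝ), ‖leftShift r.toNNReal f t‖ ^ 2 : ℝ) : ℂ) := by
          rw [← integral_complex_ofReal]
          simpa using h7
        exact (Complex.ofReal_injective h8).symm
      calc ∫ t, ‖f (r + t)‖ ^ 2 ∂ν = ∫ t, ‖leftShift r.toNNReal f t‖ ^ 2 ∂ν := by
            refine integral_congr_ae ?_
            filter_upwards [ae_mono hνle h4] with t ht
            rw [ht, add_comm]
        _ ≤ ∫ t in Ioi (0 : ℝ), ‖leftShift r.toNNReal f t‖ ^ 2 :=
            integral_mono_measure hνle (Eventually.of_forall fun t => by positivity)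
              ((Lp.memLp (leftShift r.toNNReal f)).integrable_norm_pow two_ne_zero)
        _ ≤ ‖f‖ ^ 2 := by rw [h6]; gcongr
    calc ∫ t, ‖f (r + t)‖ ∂ν ≤ ∫ t, (1 + ‖f (r + t)‖ ^ 2) ∂ν := by
          refine integral_mono ((hsq r hr).integrable one_le_two).norm
            ((integrable_const _).add h2) fun t => ?_
          simp only
          nlinarith [sq_nonneg (‖f (r + t)‖ - 1), norm_nonneg (f (r + t))]
      _ = ν.real univ + ∫ t, ‖f (r + t)‖ ^ 2 ∂ν := by
          rw [integral_add (integrable_const _) h2, integral_const, smul_eq_mul, mul_one]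
      _ ≤ _ := by gcongr
  rw [integrable_prod_iff hmeas]
  constructor
  · filter_upwards [ae_restrict_mem measurableSet_Ioi] with r hr
    exact ((hsq r hr).integrable one_le_two).const_mul _
  · have h1 := (integrableOn_exp_mul_complex_Ioi (a := -s) (by simpa using hs) 0).norm.mul_const
      (ν.real univ + ‖f‖ ^ 2)
    refine h1.mono' hmeas.norm.integral_prod_right' ?_
    filter_upwards [ae_restrict_mem measurableSet_Ioi] with r hr
    simp only [norm_mul]
    rw [integral_const_mul, norm_mul, norm_norm]
    gcongr
    rw [Real.norm_of_nonneg (integral_nonneg fun t => norm_nonneg _)]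
    exact hbound r hr

section Calculus

variable {X : Type*} [NormedAddCommGroup X] [NormedSpace ℂ X] {T : C0Semigroup X}
  {Z : Type*} [NormedAddCommGroup Z] [NormedSpace ℂ Z] {B : X →L[ℂ] Z →L[ℂ] L2pos}

theorem weaklyAdmissible_iff_leftShift : WeaklyAdmissible T B ↔
    ∀ τ : ℝ≥0, 0 < τ → ∀ (x : X) (y : Z), leftShift τ (B x y) = B (T.op τ x) y := by
  refine forall_congr' fun τ => forall_congr' fun _ => forall_congr' fun x => forall_congr' fun y =>
    ⟨fun h => Lp.ext ?_, fun h => ?_⟩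
  · filter_upwards [leftShift_ae τ (B x y), h] with t h1 h2
    rw [h1, h2]
  · rw [← h]
    filter_upwards [leftShift_ae τ (B x y)] with t h1
    rw [h1]

/-- The bilinear map `(x, y) ↦ L (B(x, y))`. -/
def postcomp {F : Type*} [NormedAddCommGroup F] [NormedSpace ℂ F] (L : L2pos →L[ℂ] F)
    (B : X →L[ℂ] Z →L[ℂ] L2pos) : X →L[ℂ] Z →L[ℂ] F :=
  (ContinuousLinearMap.compL ℂ Z L2pos F L).comp B

theorem postcomp_apply {F : Type*} [NormedAddCommGroup F] [NormedSpace ℂ F] (L : L2pos →L[ℂ] F)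
    (B : X →L[ℂ] Z →L[ℂ] L2pos) (x : X) (y : Z) : postcomp L B x y = L (B x y) := rfl

theorem WeaklyAdmissible.toeplitz (hB : WeaklyAdmissible T B) (g : HInfLeft) :
    WeaklyAdmissible T (postcomp g.toeplitzL B) := by
  rw [weaklyAdmissible_iff_leftShift] at hB ⊢
  intro τ hτ x y
  rw [postcomp_apply, postcomp_apply, HInfLeft.toeplitzL_apply, ← HInfLeft.toeplitz_leftShift,
    hB τ hτ, HInfLeft.toeplitzL_apply]

/-- The observation operator of an output mapping `B`, computed at the point `s`:
`x ↦ (y ↦ ∫₀^∞ exp(-st) B((s - A)x, y)(t) dt)`. -/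
def observation (T : C0Semigroup X) {s : ℂ} (hs : 0 < s.re) (B : X →L[ℂ] Z →L[ℂ] L2pos) :
    T.X1 →L[ℂ] StrongDual ℂ Z :=
  (postcomp (laplaceAt s hs) B).comp (T.subGenL s)

theorem observation_apply {s : ℂ} (hs : 0 < s.re) (x : T.X1) (y : Z) :
    observation T hs B x y = laplaceAt s hs (B (T.subGenL s x) y) := rfl

theorem observation_onX1 (hB : WeaklyAdmissible T B) {s : ℂ} (hs : 0 < s.re) {t : ℝ} (ht : 0 < t)
    (x : T.X1) (y : Z) : observation T hs B (T.onX1 t.toNNReal x) y =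
      ∫ r in Ioi (0 : ℝ), Complex.exp (-s * r) * B (T.subGenL s x) y (r + t) := by
  rw [observation_apply, C0Semigroup.subGenL_onX1,
    ← weaklyAdmissible_iff_leftShift.1 hB _ (Real.toNNReal_pos.2 ht), laplaceAt_leftShift,
    Real.coe_toNNReal _ ht.le]

/-- Weiss's representation theorem: a weakly admissible output mapping is `⟨y, C T(·)x⟩` for
`x ∈ D(A)`, where `C` is its observation operator. Both sides have the same integral over every set
of finite measure, by the Laplace transform formula for the resolvent and Fubini's theorem. -/
theorem ae_eq_observation [CompleteSpace X] (hT : T.ExpStable) (hB : WeaklyAdmissible T B) {s : ℂ}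
    (hs : 0 < s.re) (x : T.X1) (y : Z) : ∀ᵐ t ∂(volume.restrict (Ioi (0 : ℝ))),
      B (T.incl x) y t = observation T hs B (T.onX1 t.toNNReal x) y := by
  set u := T.subGenL s x with hu
  have hswap : ∀ A : Set ℝ, MeasurableSet A → volume.restrict (Ioi (0 : ℝ)) A < ∞ →
      IntegrableOn (fun t : ℝ => observation T hs B (T.onX1 t.toNNReal x) y) A
          (volume.restrict (Ioi (0 : ℝ))) ∧
        ∫ t in A, B (T.incl x) y t ∂(volume.restrict (Ioi (0 : ℝ))) =
        ∫ t in A, observation T hs B (T.onX1 t.toNNReal x) y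
          ∂(volume.restrict (Ioi (0 : ℝ))) := fun A hA hμA => by
    have hP := integrable_prod_exp_mul_shift hs (B u y) hμA
    have hobs : ∀ᵐ t ∂((volume.restrict (Ioi (0 : ℝ))).restrict A),
        ∫ r in Ioi (0 : ℝ), Complex.exp (-s * r) * B u y (r + t) =
          observation T hs B (T.onX1 t.toNNReal x) y := by
      filter_upwards [ae_restrict_of_ae (ae_restrict_mem measurableSet_Ioi)] with t ht
      rw [observation_onX1 hB hs ht]
    refine ⟨hP.integral_prod_right.congr hobs, ?_⟩
    set φ : L2pos := indicatorConstLp 2 hA hμA.ne (1 : ℂ) with hφ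
    have hφi : ∀ f : L2pos, innerSL ℂ φ f = ∫ t in A, f t ∂(volume.restrict (Ioi (0 : ℝ))) :=
      fun f => L2.inner_indicatorConstLp_one hA hμA.ne f
    set ℓ : X →L[ℂ] ℂ := ((postcomp (innerSL ℂ φ) B).flip y) with hℓ
    have hℓx : ∀ v, ℓ v = ∫ t in A, B v y t ∂(volume.restrict (Ioi (0 : ℝ))) := fun v => hφi _
    calc ∫ t in A, B (T.incl x) y t ∂(volume.restrict (Ioi (0 : ℝ)))
        = ℓ (C0Semigroup.resolventL hT hs u) := by
          rw [hu, C0Semigroup.subGenL_apply, C0Semigroup.resolventL_gen, hℓx]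
      _ = ∫ r in Ioi (0 : ℝ), ∫ t in A, Complex.exp (-s * r) * B u y (r + t)
            ∂(volume.restrict (Ioi (0 : ℝ))) := by
          rw [C0Semigroup.resolventL_apply, ← ContinuousLinearMap.integral_comp_comm _
            (hT.integrableOn_exp_smul_orbit hs u)]
          refine setIntegral_congr_fun measurableSet_Ioi fun r hr => ?_
          rw [map_smul, hℓx, smul_eq_mul, integral_const_mul,
            ← weaklyAdmissible_iff_leftShift.1 hB _ (Real.toNNReal_pos.2 hr)]
          congr 1
          refine integral_congr_ae (ae_restrict_of_ae ?_)
          filter_upwards [leftShift_ae r.toNNReal (B u y)] with t ht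
          rw [ht, Real.coe_toNNReal _ (le_of_lt hr), add_comm]
      _ = ∫ t in A, (∫ r in Ioi (0 : ℝ), Complex.exp (-s * r) * B u y (r + t))
            ∂(volume.restrict (Ioi (0 : ℝ))) := integral_integral_swap hP
      _ = _ := integral_congr_ae hobs
  refine ae_eq_of_forall_setIntegral_eq_of_sigmaFinite (fun A hA hμA => ?_)
    (fun A hA hμA => (hswap A hA hμA).1) fun A hA hμA => (hswap A hA hμA).2
  have : IsFiniteMeasure ((volume.restrict (Ioi (0 : ℝ))).restrict A) :=
    ⟨by rwa [Measure.restrict_apply_univ]⟩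
  exact ((Lp.memLp _).restrict A).integrable one_le_two

theorem isCalculusOp_observation [CompleteSpace X] (hT : T.ExpStable) (hB : WeaklyAdmissible T B)
    (g : HInfLeft) {s : ℂ} (hs : 0 < s.re) :
    IsCalculusOp T B g (observation T hs (postcomp g.toeplitzL B)) :=
  fun y x => ae_eq_observation hT (hB.toeplitz g) hs x y

theorem IsCalculusOp.unique (hT : T.ExpStable) {g : HInfLeft}
    {G G' : T.X1 →L[ℂ] StrongDual ℂ Z} (hG : IsCalculusOp T B g G) (hG' : IsCalculusOp T B g G') :
    G = G' := by
  ext x y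
  have hc : ∀ H : T.X1 →L[ℂ] StrongDual ℂ Z, Continuous fun t : ℝ => H (T.onX1 t.toNNReal x) y :=
    fun H => (H.flip y).continuous.comp ((hT.continuous_onX1 x).comp continuous_real_toNNReal)
  have hae : (fun t : ℝ => G (T.onX1 t.toNNReal x) y) =ᵐ[volume.restrict (Ioi (0 : ℝ))]
      fun t : ℝ => G' (T.onX1 t.toNNReal x) y := by
    filter_upwards [hG y x, hG' y x] with t h1 h2
    rw [← h1, ← h2]
  have heq := (Measure.eqOn_open_of_ae_eq hae isOpen_Ioi (hc G).continuousOn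
    (hc G').continuousOn).closure (hc G) (hc G')
  have h0 := heq (x := 0) (by rw [closure_Ioi]; exact self_mem_Ici)
  simpa [C0Semigroup.onX1_zero] using h0

theorem IsCalculusOp.eq_observation [CompleteSpace X] (hT : T.ExpStable)
    (hB : WeaklyAdmissible T B) {g : HInfLeft} {G : T.X1 →L[ℂ] StrongDual ℂ Z}
    (hG : IsCalculusOp T B g G) {s : ℂ} (hs : 0 < s.re) :
    G = observation T hs (postcomp g.toeplitzL B) :=
  hG.unique hT (isCalculusOp_observation hT hB g hs)

/-- The point `s` of the resolvent is also the point at which the observation operator is computed,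
whence `G R x = (y ↦ ∫₀^∞ exp(-st) M_g(B(x, y))(t) dt)`. -/
theorem IsCalculusOp.norm_comp_resolvent_le [CompleteSpace X] (hT : T.ExpStable)
    (hB : WeaklyAdmissible T B) {g : HInfLeft} {G : T.X1 →L[ℂ] StrongDual ℂ Z}
    (hG : IsCalculusOp T B g G) {s : ℂ} (hs : 0 < s.re) {R : X →L[ℂ] T.X1}
    (hR : T.IsResolvent s R) (x : X) :
    ‖G (R x)‖ ≤ ‖B‖ / √s.re * g.supNorm * ‖x‖ := by
  have h0 := g.supNorm_nonneg
  refine ContinuousLinearMap.opNorm_le_bound _ (by positivity) fun y => ?_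
  rw [hG.eq_observation hT hB hs, observation_apply, C0Semigroup.subGenL_apply, hR.1,
    postcomp_apply]
  calc ‖laplaceAt s hs (g.toeplitzL (B x y))‖
      ≤ 1 / √s.re * ‖g.toeplitz (B x y)‖ := norm_laplaceAt_le hs _
    _ ≤ 1 / √s.re * (g.supNorm * (‖B‖ * ‖x‖ * ‖y‖)) := by
        gcongr
        exact (g.norm_toeplitz_le _).trans (by gcongr; exact B.le_opNorm₂ x y)
    _ = ‖B‖ / √s.re * g.supNorm * ‖x‖ * ‖y‖ := by ring

/-- Every orbit is dominated by one fixed element of `L²(0,∞)`. -/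
theorem exists_norm_orbit_le (hT : T.ExpStable) : ∃ C : ℝ, 0 ≤ C ∧ ∃ e : L2pos, ∀ x : X,
    ∀ᵐ t ∂(volume.restrict (Ioi (0 : ℝ))), ‖T.op t.toNNReal x‖ ≤ C * ‖x‖ * ‖e t‖ := by
  obtain ⟨M, ω, hM, hω, h⟩ := hT.exists_bound
  have hω' : 0 < (ω : ℂ).re := by simpa using hω
  refine ⟨M, hM, expL2 ω hω', fun x => ?_⟩
  filter_upwards [expL2_ae hω', ae_restrict_mem measurableSet_Ioi] with t ht h0
  rw [ht, norm_exp_neg_mul]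
  refine (h _ x).trans_eq ?_
  rw [Real.coe_toNNReal _ (le_of_lt h0), Complex.ofReal_re]
  ring

theorem exists_isOrbitOutput (hT : T.ExpStable) :
    ∃ B : X →L[ℂ] StrongDual ℂ X →L[ℂ] L2pos, IsOrbitOutput T B := by
  obtain ⟨C, hC, e, he⟩ := exists_norm_orbit_le hT
  have hb : ∀ (x : X) (y : StrongDual ℂ X), ∀ᵐ t ∂(volume.restrict (Ioi (0 : ℝ))),
      ‖y (T.op t.toNNReal x)‖ ≤ C * ‖x‖ * ‖y‖ * ‖e t‖ := fun x y => by
    filter_upwards [he x] with t ht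
    calc ‖y (T.op t.toNNReal x)‖ ≤ ‖y‖ * ‖T.op t.toNNReal x‖ := y.le_opNorm _
      _ ≤ ‖y‖ * (C * ‖x‖ * ‖e t‖) := by gcongr
      _ = _ := by ring
  have hmem : ∀ (x : X) (y : StrongDual ℂ X),
      MemLp (fun t : ℝ => y (T.op t.toNNReal x)) 2 (volume.restrict (Ioi (0 : ℝ))) := fun x y =>
    (Lp.memLp e).of_le_mul
      (y.continuous.comp (hT.continuous_orbit_real x)).aestronglyMeasurable (hb x y)
  let f : X →ₗ[ℂ] StrongDual ℂ X →ₗ[ℂ] L2pos := LinearMap.mk₂ ℂ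
    (fun x y => (hmem x y).toLp _)
    (fun x x' y => by
      rw [← MemLp.toLp_add, MemLp.toLp_eq_toLp_iff]
      exact Eventually.of_forall fun t => by simp)
    (fun c x y => by
      rw [← MemLp.toLp_const_smul, MemLp.toLp_eq_toLp_iff]
      exact Eventually.of_forall fun t => by simp)
    (fun x y y' => by
      rw [← MemLp.toLp_add, MemLp.toLp_eq_toLp_iff]
      exact Eventually.of_forall fun t => by simp)
    (fun c x y => by
      rw [← MemLp.toLp_const_smul, MemLp.toLp_eq_toLp_iff]
      exact Eventually.of_forall fun t => by simp)
  refine ⟨f.mkContinuous₂ (C * ‖e‖) fun x y => ?_, fun x y => (hmem x y).coeFn_toLp⟩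
  have h1 : ‖f x y‖ ≤ C * ‖x‖ * ‖y‖ * ‖e‖ := by
    refine Lp.norm_le_mul_norm_of_ae_le_mul ?_
    filter_upwards [hb x y, (hmem x y).coeFn_toLp] with t h2 h3
    change ‖(hmem x y).toLp _ t‖ ≤ _
    rwa [h3]
  refine h1.trans_eq ?_
  ring

theorem IsOrbitOutput.weaklyAdmissible {B : X →L[ℂ] StrongDual ℂ X →L[ℂ] L2pos}
    (hB : IsOrbitOutput T B) : WeaklyAdmissible T B := by
  intro τ hτ x y
  filter_upwards [ae_comp_add_right τ.coe_nonneg (hB x y), hB (T.op τ x) y,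
    ae_restrict_mem measurableSet_Ioi] with t h1 h2 ht
  rw [h1, h2, Real.toNNReal_add (le_of_lt ht) τ.coe_nonneg, Real.toNNReal_coe,
    C0Semigroup.op_add_apply]

/-- If `B(x, y) = ⟨y, T(·)x⟩`, then a bounded functional of `B(x, y) ∈ L²(0,∞)`, seen as a
functional of `y`, is evaluation at a point of `X`: it is integration against some `k ∈ L²(0,∞)`, and the
Bochner integral `∫₀^∞ k(t) T(t)x dt` exists. -/
theorem IsOrbitOutput.exists_eq_inclusion [CompleteSpace X] (hT : T.ExpStable)
    {B : X →L[ℂ] StrongDual ℂ X →L[ℂ] L2pos} (hB : IsOrbitOutput T B) (ℓ : L2pos →L[ℂ] ℂ) (x : X) :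
    ∃ v : X, ∀ y : StrongDual ℂ X, ℓ (B x y) = y v := by
  set k : L2pos := (InnerProductSpace.toDual ℂ L2pos).symm ℓ with hk
  obtain ⟨C, hC, e, he⟩ := exists_norm_orbit_le hT
  have hint : IntegrableOn (fun t : ℝ => starRingEnd ℂ (k t) • T.op t.toNNReal x) (Ioi 0) := by
    have h1 := ((Lp.memLp k).integrable_mul (Lp.memLp e)).norm.const_mul (C * ‖x‖)
    refine h1.mono' ?_ ?_
    · exact (Complex.continuous_conj.comp_aestronglyMeasurable (Lp.aestronglyMeasurable k)).smul
        (hT.continuous_orbit_real x).aestronglyMeasurable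
    · filter_upwards [he x] with t ht
      rw [norm_smul, RCLike.norm_conj, Pi.mul_apply, norm_mul]
      calc ‖k t‖ * ‖T.op t.toNNReal x‖ ≤ ‖k t‖ * (C * ‖x‖ * ‖e t‖) := by gcongr
        _ = _ := by ring
  refine ⟨∫ t in Ioi (0 : ℝ), starRingEnd ℂ (k t) • T.op t.toNNReal x, fun y => ?_⟩
  rw [← ContinuousLinearMap.integral_comp_comm _ hint]
  have h2 : ℓ (B x y) = inner ℂ k (B x y) := by
    rw [hk, InnerProductSpace.toDual_symm_apply]
  rw [h2, L2.inner_def]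
  refine integral_congr_ae ?_
  filter_upwards [hB x y] with t ht
  rw [ht, RCLike.inner_apply, map_smul, smul_eq_mul, mul_comm]

/-- A bounded operator with values in the range of an isometry factors through it. -/
theorem LinearIsometry.exists_eq_comp {E F : Type*} [NormedAddCommGroup E] [NormedSpace ℂ E]
    [NormedAddCommGroup F] [NormedSpace ℂ F] (J : X →ₗᵢ[ℂ] F) (G : E →L[ℂ] F)
    (h : ∀ u, ∃ v, J v = G u) :
    ∃ G₀ : E →L[ℂ] X, G = J.toContinuousLinearMap.comp G₀ := by
  choose v hv using h
  let L : E →ₗ[ℂ] X :=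
    { toFun := v
      map_add' := fun u u' => J.injective (by rw [map_add, hv, hv, hv, map_add])
      map_smul' := fun c u => J.injective (by
        rw [map_smul, hv, hv, map_smul, RingHom.id_apply]) }
  refine ⟨L.mkContinuous ‖G‖ fun u => ?_, ?_⟩
  · change ‖v u‖ ≤ _
    rw [← J.norm_map, hv]
    exact G.le_opNorm u
  · ext u
    exact (hv u).symm

end Calculus

end

theorem theorem2p6 {X : Type*} [NormedAddCommGroup X] [NormedSpace ℂ X] [CompleteSpace X]
    (T : C0Semigroup X) (hT : T.ExpStable) :
    -- the calculus for a general weakly admissible output mapping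
    (∀ (Z : Type*) [NormedAddCommGroup Z] [NormedSpace ℂ Z] [CompleteSpace Z]
      (B : X →L[ℂ] Z →L[ℂ] L2pos), WeaklyAdmissible T B →
        (∀ g : HInfLeft, ∃! G : T.X1 →L[ℂ] StrongDual ℂ Z, IsCalculusOp T B g G) ∧
        ∃ α : ℝ, 0 < α ∧ ∀ (g : HInfLeft) (G : T.X1 →L[ℂ] StrongDual ℂ Z),
          IsCalculusOp T B g G → ∀ s : ℂ, 0 < s.re →
            ∃ R : X →L[ℂ] T.X1, T.IsResolvent s R ∧
              ∀ x : X, ‖G (R x)‖ ≤ α / √s.re * g.supNorm * ‖x‖) ∧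
    -- the output mapping `B(x,y) = ⟨y, T(·)x⟩`
    (∃ B : X →L[ℂ] StrongDual ℂ X →L[ℂ] L2pos, IsOrbitOutput T B ∧ WeaklyAdmissible T B) ∧
    (∀ B : X →L[ℂ] StrongDual ℂ X →L[ℂ] L2pos, IsOrbitOutput T B →
      ∀ (g : HInfLeft) (G : T.X1 →L[ℂ] StrongDual ℂ (StrongDual ℂ X)), IsCalculusOp T B g G →
        ∃ G₀ : T.X1 →L[ℂ] X,
          G = (NormedSpace.inclusionInDoubleDual ℂ X).comp G₀ ∧
          ∀ (y : StrongDual ℂ X) (x₁ : T.X1), ∀ᵐ t ∂(volume.restrict (Ioi (0 : ℝ))),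
            outputMap B g y (T.incl x₁) t = y (G₀ (T.onX1 t.toNNReal x₁))) ∧
    -- commutation with the semigroup
    (∀ B : X →L[ℂ] StrongDual ℂ X →L[ℂ] L2pos, WeaklyAdmissible T B →
      (∀ (t : ℝ≥0) (x : X) (y : StrongDual ℂ X), B (T.op t x) y = B x (y.comp (T.op t))) →
        ∀ (g : HInfLeft) (G : T.X1 →L[ℂ] StrongDual ℂ (StrongDual ℂ X)), IsCalculusOp T B g G →
          ∀ (t : ℝ≥0) (x₁ : T.X1) (y : StrongDual ℂ X),
            G (T.onX1 t x₁) y = G x₁ (y.comp (T.op t))) := by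
  have h1 : (0 : ℝ) < (1 : ℂ).re := by simp
  refine ⟨fun Z _ _ _ B hB => ⟨fun g => ?_, ‖B‖ + 1, by positivity, fun g G hG s hs => ?_⟩, ?_,
    fun B hB g G hG => ?_, fun B hB hBT g G hG t x₁ y => ?_⟩
  · exact ⟨_, isCalculusOp_observation hT hB g h1,
      fun G hG => hG.unique hT (isCalculusOp_observation hT hB g h1)⟩
  · obtain ⟨R, hR⟩ := C0Semigroup.exists_isResolvent hT hs
    refine ⟨R, hR, fun x => (hG.norm_comp_resolvent_le hT hB hs hR x).trans ?_⟩
    have h0 := g.supNorm_nonneg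
    gcongr
    linarith
  · obtain ⟨B, hB⟩ := exists_isOrbitOutput hT
    exact ⟨B, hB, hB.weaklyAdmissible⟩
  · have hobs := hG.eq_observation hT hB.weaklyAdmissible h1
    obtain ⟨G₀, hG₀⟩ := LinearIsometry.exists_eq_comp (E := T.X1)
        (F := StrongDual ℂ (StrongDual ℂ X)) (NormedSpace.inclusionInDoubleDualLi ℂ) G fun x₁ => by
      obtain ⟨v, hv⟩ := hB.exists_eq_inclusion hT ((laplaceAt 1 h1).comp g.toeplitzL)
        (T.subGenL 1 x₁)
      exact ⟨v, ContinuousLinearMap.ext fun y => by rw [hobs]; exact (hv y).symm⟩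
    refine ⟨G₀, hG₀, fun y x₁ => ?_⟩
    filter_upwards [hG y x₁] with t ht
    rw [ht, hG₀]
    rfl
  · rw [hG.eq_observation hT hB h1, observation_apply, observation_apply,
      C0Semigroup.subGenL_onX1, postcomp_apply, postcomp_apply, hBT]
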